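/- **Conventions.** A nonempty simplicial complex $X$ with vertex set $V(X)$ is called $r$-ample if for every set $U\subseteq V(X)$ with $|U|\le r$ and every subcomplex $A$ (possibly empty) of the induced subcomplex $X_U$ there is a vertex $v\in V(X)\setminus U$ with $\mathrm{Lk}_X(v)\cap X_U=A$. A simplicial loop with $n$ vertices in $Y$ ($n\ge 3$) is a simplicial map $\alpha:C_n\to Y$, where $C_n$ is the triangulation of the circle $S^1$ with $n$ vertices; neither injectivity nor non-degeneracy is required. It bounds a simplicial disc if there are a triangulation $D$ of the disc $D^2$ with exactly $n$ boundary vertices, whose boundary circle is identified with $C_n$, and a simplicial map $\beta:D\to Y$ which restricts to $\alpha$ on the boundary. The geometric realization $|Y|$ carries the weak topology. **Proposition 6.1.** Let $r\ge 4$ and let $Y$ be an $r$-ample simplicial complex. Then $|Y|$ is simply connected. Moreover, for every $n\ge 3$, every simplicial loop $\alpha: S^1\to Y$ with $n$ vertices bounds a simplicial disc $\beta:D^2\to Y$, where $D^2$ is a triangulation of the disc having $n$ boundary vertices, at most $$\max\left(1,\left\lceil\frac{n-3}{r-3}\right\rceil\right)$$ interior vertices and at most $$\max\left(3,\left\lceil\frac{n-3}{r-3}\right\rceil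 (r-1)+1\right)$$ triangles. (For $n\ge 4$ these are $\lceil\frac{n-3}{r-3}\rceil$ and $\lceil\frac{n-3}{r-3}\rceil(r-1)+1$; for $n=3$ they are $1$ and $3$.) -/

import Mathlib

namespace AbstractSimplicialComplex

/-- The induced subcomplex `X_U`: all simplexes of `X` with vertices in `U`. -/
def induced {V : Type*} (X : AbstractSimplicialComplex V) (U : Set V) :
    PreAbstractSimplicialComplex V where
  faces := {s | s ∈ X ∧ (s : Set V) ⊆ U}
  isRelLowerSet_faces := by
    rintro s ⟨hs, hU⟩
    refine ⟨(X.isRelLowerSet_faces hs).1, fun t hts ht => ⟨?_, ?_⟩⟩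
    · exact (X.isRelLowerSet_faces hs).2 hts ht
    · exact (Finset.coe_subset.mpr hts).trans hU

/-- The link of the vertex `v` in `X`: all simplexes `s` of `X` not containing `v` such that
`s ∪ {v}` is a simplex of `X`. -/
def link {V : Type*} (X : AbstractSimplicialComplex V) (v : V) :
    PreAbstractSimplicialComplex V where
  faces := {s | s ∈ X ∧ ∃ h : v ∉ s, s.cons v h ∈ X}
  isRelLowerSet_faces := by
    rintro s ⟨hs, hv, hc⟩
    refine ⟨(X.isRelLowerSet_faces hs).1, fun t hts ht => ⟨?_, fun h => hv (hts h), ?_⟩⟩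
    · exact (X.isRelLowerSet_faces hs).2 hts ht
    · exact (X.isRelLowerSet_faces hc).2 (Finset.cons_subset_cons.mpr hts)
        (Finset.cons_nonempty _)

/-- `X` is `r`-ample: it is nonempty, and for every set `U` of at most `r` vertices and every
subcomplex `A` of `X_U` there is a vertex `v ∉ U` with `Lk_X(v) ∩ X_U = A`. The vertex set of `X`
is the whole type `V`, while the subcomplex `A` may have fewer vertices than `U`
(and may be empty). -/
def IsAmple {V : Type*} (X : AbstractSimplicialComplex V) (r : ℕ) : Prop :=
  Nonempty V ∧
    ∀ U : Finset V, U.card ≤ r →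
      ∀ A : PreAbstractSimplicialComplex V, A ≤ X.induced (U : Set V) →
        ∃ v : V, v ∉ U ∧ X.link v ⊓ X.induced (U : Set V) = A

/-- The underlying set of the geometric realization `|X|`, in barycentric coordinates:
finitely supported functions `V → [0, ∞)` of total mass `1` whose support is a simplex of `X`. -/
def Realization {V : Type*} (X : AbstractSimplicialComplex V) : Type _ :=
  {x : V →₀ ℝ // (∀ v, 0 ≤ x v) ∧ (x.sum fun _ t => t) = 1 ∧ x.support ∈ X}

/-- The closed geometric simplex of `|X|` spanned by the vertices in `s`. -/
def closedSimplex {V : Type*} (X : AbstractSimplicialComplex V) (s : Finset V) :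
    Set X.Realization :=
  {x | x.1.support ⊆ s}

/-- The Euclidean topology on a closed simplex: the one induced by the barycentric coordinates. -/
abbrev closedSimplexTopology {V : Type*} (X : AbstractSimplicialComplex V) (s : Finset V) :
    TopologicalSpace (X.closedSimplex s) :=
  TopologicalSpace.induced (fun x => (fun v : V => x.1.1 v)) inferInstance

/-- The weak (coherent, CW) topology on `|X|`: a set is open (closed) if and only if its
intersection with every closed simplex of `X` is open (closed) in the Euclidean topology of that
simplex. -/
instance {V : Type*} (X : AbstractSimplicialComplex V) : TopologicalSpace X.Realization :=
  ⨆ s : {s : Finset V // s ∈ X},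
    TopologicalSpace.coinduced (Subtype.val : X.closedSimplex s.1 → X.Realization)
      (X.closedSimplexTopology s.1)

open Classical in
/-- A vertex map is simplicial if it takes simplexes to simplexes (possibly of lower dimension). -/
def IsSimplicialMap {V W : Type*} (K : AbstractSimplicialComplex V)
    (L : AbstractSimplicialComplex W) (f : V → W) : Prop :=
  ∀ s ∈ K, s.image f ∈ L

/-- The cycle with vertices `ℤ/n` and edges `{i, i+1}`; for `n ≥ 3` it is the triangulation of the
circle `S¹` with `n` vertices. -/
def cycle (n : ℕ) : AbstractSimplicialComplex (ZMod n) where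
  faces := {s | s.Nonempty ∧ ∃ i : ZMod n, s ⊆ {i, i + 1}}
  isRelLowerSet_faces := by
    rintro s ⟨hs, i, hi⟩
    exact ⟨hs, fun t hts ht => ⟨ht, i, hts.trans hi⟩⟩
  singleton_mem v := ⟨Finset.singleton_nonempty v, v, by simp⟩

/-- `D` is a triangulation of the disc `D²` whose boundary circle is the `n`-cycle
with consecutive vertices `b i`, `i ∈ ℤ/n`: the map `b` embeds the `n`-cycle in `D`, and some
homeomorphism of `|D|` onto the closed unit disc of the plane takes exactly the points of the
image of that cycle to the unit circle. In particular `D` has exactly `n` boundary vertices. -/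
structure IsDiscTriangulation {W : Type*} (D : AbstractSimplicialComplex W) (n : ℕ)
    (b : ZMod n → W) : Prop where
  injective : Function.Injective b
  isSimplicialMap : IsSimplicialMap (cycle n) D b
  exists_homeomorph : ∃ h : D.Realization ≃ₜ Metric.closedBall (0 : EuclideanSpace ℝ (Fin 2)) 1,
    ∀ x : D.Realization,
      (h x : EuclideanSpace ℝ (Fin 2)) ∈ Metric.sphere (0 : EuclideanSpace ℝ (Fin 2)) 1 ↔
        ∃ i : ZMod n, (x.1.support : Set W) ⊆ {b i, b (i + 1)}

end AbstractSimplicialComplex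

open Topology

namespace AbstractSimplicialComplex

/-! ### The weak topology in barycentric coordinates -/

namespace Realization

variable {V : Type*} {X : AbstractSimplicialComplex V}

theorem ext_coord {x y : X.Realization} (h : ∀ v, x.1 v = y.1 v) : x = y :=
  Subtype.ext (Finsupp.ext h)

theorem support_mem (x : X.Realization) : x.1.support ∈ X := x.2.2.2

theorem coord_nonneg (x : X.Realization) (v : V) : 0 ≤ x.1 v := x.2.1 v

theorem sum_eq_one (x : X.Realization) {s : Finset V} (hs : x.1.support ⊆ s) :
    ∑ v ∈ s, x.1 v = 1 := by
  exact (Finsupp.sum_of_support_subset _ hs (fun _ t => t) (by simp)).symm.trans x.2.2.1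

theorem continuous_coord (v : V) : Continuous fun x : X.Realization => x.1 v := by
  refine continuous_iSup_dom.2 fun s => continuous_coinduced_dom.2 ?_
  have h : Continuous[X.closedSimplexTopology s.1, _]
      fun x : X.closedSimplex s.1 => fun v => x.1.1 v := continuous_induced_dom
  let _ := X.closedSimplexTopology s.1
  exact (continuous_apply v).comp h

instance : T2Space X.Realization :=
  T2Space.of_injective_continuous (f := fun x : X.Realization => fun v => x.1 v)
    (fun _ _ h => ext_coord fun v => congrFun h v) (continuous_pi continuous_coord)

theorem continuous_inclusion {s : Finset V} (hs : s ∈ X) :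
    Continuous[X.closedSimplexTopology s, _] (Subtype.val : X.closedSimplex s → X.Realization) :=
  continuous_iSup_rng (i := (⟨s, hs⟩ : {s : Finset V // s ∈ X})) continuous_coinduced_rng

theorem isClosed_iff {A : Set X.Realization} :
    IsClosed A ↔ ∀ s ∈ X, IsClosed[X.closedSimplexTopology s]
      (Subtype.val ⁻¹' A : Set (X.closedSimplex s)) := by
  refine isClosed_iSup_iff.trans ⟨fun h s hs => ?_, fun h s => ?_⟩
  · exact isClosed_coinduced.1 (h ⟨s, hs⟩)
  · exact isClosed_coinduced.2 (h s.1 s.2)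

/-- The point of the realization with given barycentric coordinates supported in a face. -/
noncomputable def ofFace {s : Finset V} (hs : s ∈ X) (f : V → ℝ) (h0 : ∀ v, 0 ≤ f v)
    (hf : ∀ v, f v ≠ 0 → v ∈ s) (h1 : ∑ v ∈ s, f v = 1) : X.Realization :=
  ⟨Finsupp.onFinset s f hf, h0, by
    rw [Finsupp.sum_of_support_subset _ Finsupp.support_onFinset_subset _ (by simp)]
    simpa using h1, by
    refine (X.isRelLowerSet_faces hs).2 Finsupp.support_onFinset_subset ?_
    rw [Finset.nonempty_iff_ne_empty, ne_eq, Finsupp.support_eq_empty]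
    intro h
    have : ∀ v, f v = 0 := fun v => by simpa using DFunLike.congr_fun h v
    simp [this] at h1⟩

@[simp]
theorem ofFace_apply {s : Finset V} (hs : s ∈ X) (f : V → ℝ) (h0 : ∀ v, 0 ≤ f v)
    (hf : ∀ v, f v ≠ 0 → v ∈ s) (h1 : ∑ v ∈ s, f v = 1) (v : V) :
    (ofFace hs f h0 hf h1).1 v = f v := rfl

theorem support_ofFace_subset {s : Finset V} (hs : s ∈ X) (f : V → ℝ) (h0 : ∀ v, 0 ≤ f v)
    (hf : ∀ v, f v ≠ 0 → v ∈ s) (h1 : ∑ v ∈ s, f v = 1) :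
    (ofFace hs f h0 hf h1).1.support ⊆ s := Finsupp.support_onFinset_subset (hf := hf)

open Classical in
theorem isCompact_closedSimplex {s : Finset V} (hs : s ∈ X) : IsCompact (X.closedSimplex s) := by
  let g : stdSimplex ℝ s → V → ℝ := fun x v => if h : v ∈ s then x.1 ⟨v, h⟩ else 0
  have g0 : ∀ x v, 0 ≤ g x v := fun x v => by
    by_cases h : v ∈ s
    · simpa [g, h] using x.2.1 ⟨v, h⟩
    · simp [g, h]
  have gs : ∀ x v, g x v ≠ 0 → v ∈ s := fun x v hv => by
    by_contra h
    simp [g, h] at hv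
  have g1 : ∀ x, ∑ v ∈ s, g x v = 1 := fun x => by
    rw [← x.2.2, ← Finset.sum_coe_sort]
    simp [g]
  let φ : stdSimplex ℝ s → X.closedSimplex s := fun x =>
    ⟨ofFace hs (g x) (g0 x) (gs x) (g1 x), support_ofFace_subset ..⟩
  have hφ : Continuous[_, X.closedSimplexTopology s] φ := by
    refine continuous_induced_rng.2 (continuous_pi fun v => ?_)
    by_cases h : v ∈ s
    · have : Continuous fun x : stdSimplex ℝ s => x.1 ⟨v, h⟩ :=
        (continuous_apply _).comp continuous_subtype_val
      simpa [φ, g, h, Function.comp_def] using this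
    · simpa [φ, g, h, Function.comp_def] using continuous_const
  have hc : Continuous fun x => (φ x).1 := 
    @Continuous.comp _ _ _ _ (X.closedSimplexTopology s) _ _ _ (continuous_inclusion hs) hφ
  convert isCompact_range hc
  ext x
  constructor
  · intro hx
    refine ⟨⟨fun v => x.1 v, fun v => x.coord_nonneg v, ?_⟩, ?_⟩
    · rw [Finset.sum_coe_sort s (fun v => x.1 v)]
      exact x.sum_eq_one hx
    · refine ext_coord fun v => ?_
      by_cases h : v ∈ s
      · simp [φ, g, h]
      · have : x.1 v = 0 := by
          by_contra h'
          exact h (hx (Finsupp.mem_support_iff.2 h'))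
        simp [φ, g, h, this]
  · rintro ⟨y, rfl⟩
    exact (φ y).2

theorem isCompact_support_subset (U : Finset V) :
    IsCompact {x : X.Realization | x.1.support ⊆ U} := by
  have : {x : X.Realization | x.1.support ⊆ U} =
      ⋃ s ∈ {s : Finset V | s ⊆ U ∧ s ∈ X}, X.closedSimplex s := by
    ext x
    simp only [Set.mem_ofPred_eq, Set.mem_iUnion, exists_prop]
    exact ⟨fun h => ⟨x.1.support, ⟨h, x.support_mem⟩, Finset.Subset.refl _⟩,
      fun ⟨s, hs, hx⟩ => Finset.Subset.trans hx hs.1⟩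
  rw [this]
  refine Set.Finite.isCompact_biUnion ?_ fun s hs => isCompact_closedSimplex hs.2
  exact (Finset.finite_toSet U.powerset).subset fun s hs => by simpa using hs.1

/-- The points supported in `U` form a compact set, so there the continuous injection given by the
coordinates is a closed embedding. -/
theorem continuous_of_coord {Z : Type*} [TopologicalSpace Z] {f : Z → X.Realization}
    (U : Finset V) (hU : ∀ z, (f z).1.support ⊆ U) (hc : ∀ v, Continuous fun z => (f z).1 v) :
    Continuous f := by
  let B : Set X.Realization := {x | x.1.support ⊆ U}
  have : CompactSpace B := isCompact_iff_compactSpace.1 (isCompact_support_subset U)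
  let Φ : B → V → ℝ := fun x v => x.1.1 v
  have hΦ : Topology.IsClosedEmbedding Φ := Continuous.isClosedEmbedding
    (continuous_pi fun v => (continuous_coord v).comp continuous_subtype_val)
    fun x y h => Subtype.ext (ext_coord fun v => congrFun h v)
  have : Continuous fun z => (⟨f z, hU z⟩ : B) :=
    hΦ.isInducing.continuous_iff.2 (continuous_pi hc)
  exact continuous_subtype_val.comp this

instance [Finite V] : CompactSpace X.Realization := by
  have := Fintype.ofFinite V
  refine ⟨?_⟩
  convert isCompact_support_subset (X := X) Finset.univ
  simp

/-- A closed simplex has finitely many faces and so meets `T` in a finite set. -/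
theorem isClosed_of_injOn_support {T : Set X.Realization}
    (hT : Set.InjOn (fun x : X.Realization => x.1.support) T) : IsClosed T := by
  refine isClosed_iff.2 fun s _ => ?_
  have hfin : (Subtype.val ⁻¹' T : Set (X.closedSimplex s)).Finite := by
    refine Set.Finite.of_finite_image
      (f := fun x : X.closedSimplex s => x.1.1.support) ?_ ?_
    · refine (Finset.finite_toSet s.powerset).subset ?_
      rintro _ ⟨x, -, rfl⟩
      exact Finset.mem_coe.2 (Finset.mem_powerset.2 x.2)
    · intro x hx y hy h
      exact Subtype.ext (hT hx hy h)
  let _ := X.closedSimplexTopology s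
  have : T2Space (X.closedSimplex s) :=
    T2Space.of_injective_continuous (f := fun x : X.closedSimplex s => fun v => x.1.1 v)
      (fun _ _ h => Subtype.ext (ext_coord fun v => congrFun h v)) continuous_induced_dom
  exact hfin.isClosed

theorem exists_support_subset_of_isCompact {K : Set X.Realization} (hK : IsCompact K) :
    ∃ U : Finset V, ∀ x ∈ K, x.1.support ⊆ U := by
  classical
  -- Choose one point of `K` for each support that occurs. All subsets of `T` are closed, so `T` is
  -- discrete and compact, hence finite.
  obtain ⟨T, hTK, hT⟩ := Set.SurjOn.exists_bijOn_subset
    (Set.surjOn_image (fun x : X.Realization => x.1.support) K)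
  have hTc : IsCompact T := hK.of_isClosed_subset (isClosed_of_injOn_support hT.injOn) hTK
  have hd : DiscreteTopology T := by
    refine discreteTopology_iff_forall_isClosed.2 fun s => ?_
    have : IsClosed (Subtype.val '' s : Set X.Realization) :=
      isClosed_of_injOn_support (hT.injOn.mono (by simp))
    rw [← Set.preimage_image_eq s Subtype.val_injective]
    exact this.preimage continuous_subtype_val
  have hfin : T.Finite := hTc.finite (isDiscrete_iff_discreteTopology.2 hd)
  refine ⟨hfin.toFinset.biUnion fun x => x.1.support, fun x hx => ?_⟩
  obtain ⟨y, hy, hxy⟩ := hT.surjOn ⟨x, hx, rfl⟩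
  simp only at hxy
  rw [← hxy]
  exact Finset.subset_biUnion_of_mem (fun x : X.Realization => x.1.support)
    (hfin.mem_toFinset.2 hy)

end Realization

open unitInterval

theorem mem_of_subset {V : Type*} {X : AbstractSimplicialComplex V} {s t : Finset V} (hs : s ∈ X)
    (hts : t ⊆ s) (ht : t.Nonempty) : t ∈ X :=
  (X.isRelLowerSet_faces hs).2 hts ht

theorem nonempty_of_mem {V : Type*} {X : AbstractSimplicialComplex V} {s : Finset V} (hs : s ∈ X) :
    s.Nonempty :=
  (X.isRelLowerSet_faces hs).1

/-- In an `r`-ample complex any `r` vertices have a common cone vertex. -/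
theorem IsAmple.exists_cone {V : Type*} [DecidableEq V] {X : AbstractSimplicialComplex V} {r : ℕ}
    (hX : X.IsAmple r) {U : Finset V} (hU : U.card ≤ r) :
    ∃ v, ∀ s ∈ X, s ⊆ U → insert v s ∈ X := by
  obtain ⟨v, -, hv⟩ := hX.2 U hU (X.induced U) le_rfl
  refine ⟨v, fun s hs hsU => ?_⟩
  have h : s ∈ (X.link v ⊓ X.induced (U : Set V)).faces := by
    rw [hv]
    exact ⟨hs, Finset.coe_subset.2 hsU⟩
  obtain ⟨⟨-, h', hc⟩, -⟩ := h
  rwa [Finset.cons_eq_insert] at hc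

/-! ### Straight-line homotopies and standard path classes -/

namespace Realization

variable {V : Type*} {X : AbstractSimplicialComplex V}

/-- Two points of the realization are near if they lie in a common closed simplex. -/
def Near (x y : X.Realization) : Prop :=
  ∃ s ∈ X, x.1.support ⊆ s ∧ y.1.support ⊆ s

theorem Near.refl (x : X.Realization) : Near x x :=
  ⟨_, x.support_mem, Finset.Subset.refl _, Finset.Subset.refl _⟩

theorem Near.symm {x y : X.Realization} (h : Near x y) : Near y x :=
  let ⟨s, hs, hx, hy⟩ := h
  ⟨s, hs, hy, hx⟩

theorem coord_eq_zero {x : X.Realization} {s : Finset V} (hx : x.1.support ⊆ s) {v : V}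
    (hv : v ∉ s) : x.1 v = 0 := by
  by_contra h
  exact hv (hx (Finsupp.mem_support_iff.2 h))

/-- The point `(1 - t) x + t y` of the realization. -/
noncomputable def mix (x y : X.Realization) (h : Near x y) (t : I) : X.Realization :=
  ofFace h.choose_spec.1 (fun v => (1 - (t : ℝ)) * x.1 v + t * y.1 v)
    (fun v => add_nonneg (mul_nonneg (sub_nonneg.2 t.2.2) (x.coord_nonneg v))
      (mul_nonneg t.2.1 (y.coord_nonneg v)))
    (fun v hv => by
      by_contra h'
      simp [coord_eq_zero h.choose_spec.2.1 h', coord_eq_zero h.choose_spec.2.2 h'] at hv)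
    (by
      rw [Finset.sum_add_distrib, ← Finset.mul_sum, ← Finset.mul_sum,
        x.sum_eq_one h.choose_spec.2.1, y.sum_eq_one h.choose_spec.2.2]
      ring)

theorem mix_apply (x y : X.Realization) (h : Near x y) (t : I) (v : V) :
    (mix x y h t).1 v = (1 - (t : ℝ)) * x.1 v + t * y.1 v := rfl

theorem support_mix_subset {x y : X.Realization} (h : Near x y) (t : I) {s : Finset V}
    (hx : x.1.support ⊆ s) (hy : y.1.support ⊆ s) : (mix x y h t).1.support ⊆ s := by
  intro v hv
  by_contra h'
  rw [Finsupp.mem_support_iff, mix_apply, coord_eq_zero hx h', coord_eq_zero hy h'] at hv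
  simp at hv

/-- Compactness of `Z` confines both maps to finitely many vertices, where continuity is tested on
coordinates. -/
theorem continuous_mix {Z : Type*} [TopologicalSpace Z] [CompactSpace Z] {f g : Z → X.Realization}
    {t : Z → I} (hf : Continuous f) (hg : Continuous g) (ht : Continuous t)
    (h : ∀ z, Near (f z) (g z)) : Continuous fun z => mix (f z) (g z) (h z) (t z) := by
  classical
  obtain ⟨U, hU⟩ := exists_support_subset_of_isCompact (isCompact_range hf)
  obtain ⟨U', hU'⟩ := exists_support_subset_of_isCompact (isCompact_range hg)
  refine continuous_of_coord (U ∪ U') (fun z => support_mix_subset _ _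
    ((hU _ ⟨z, rfl⟩).trans Finset.subset_union_left)
    ((hU' _ ⟨z, rfl⟩).trans Finset.subset_union_right)) fun v => ?_
  have h1 := (continuous_coord v).comp hf
  have h2 := (continuous_coord v).comp hg
  simp only [mix_apply]
  exact ((continuous_const.sub (continuous_subtype_val.comp ht)).mul h1).add
    ((continuous_subtype_val.comp ht).mul h2)

theorem homotopic_of_near {x y : X.Realization} {p q : Path x y} (h : ∀ t, Near (p t) (q t)) :
    p.Homotopic q := by
  refine ⟨⟨⟨⟨fun z => mix (p z.2) (q z.2) (h z.2) z.1, ?_⟩, fun t => ?_, fun t => ?_⟩,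
    fun t z hz => ?_⟩⟩
  · exact continuous_mix (p.continuous.comp continuous_snd) (q.continuous.comp continuous_snd)
      continuous_fst _
  · exact ext_coord fun v => by simp [mix_apply]
  · exact ext_coord fun v => by simp [mix_apply]
  · rcases hz with rfl | rfl <;> refine ext_coord fun v => ?_ <;> simp [mix_apply] <;> ring

/-- The straight path between two near points. -/
noncomputable def segment {x y : X.Realization} (h : Near x y) : Path x y where
  toFun t := mix x y h t
  continuous_toFun := continuous_mix continuous_const continuous_const continuous_id fun _ => h
  source' := ext_coord fun v => by simp [mix_apply]
  target' := ext_coord fun v => by simp [mix_apply]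

theorem support_segment_subset {x y : X.Realization} (h : Near x y) (t : I) {s : Finset V}
    (hx : x.1.support ⊆ s) (hy : y.1.support ⊆ s) : (segment h t).1.support ⊆ s :=
  support_mix_subset h t hx hy

/-- The homotopy class of the straight path between two near points. -/
noncomputable def segmentClass {x y : X.Realization} (h : Near x y) :
    Path.Homotopic.Quotient x y :=
  .mk (segment h)

theorem segmentClass_self {x : X.Realization} (h : Near x x) :
    segmentClass h = .refl x := by
  rw [← Path.Homotopic.Quotient.mk_refl]
  refine Path.Homotopic.Quotient.eq.2 (homotopic_of_near fun t => ?_)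
  exact ⟨_, x.support_mem, support_segment_subset h t subset_rfl subset_rfl, subset_rfl⟩

theorem segmentClass_trans {x y z : X.Realization} {s : Finset V} (hs : s ∈ X)
    (hx : x.1.support ⊆ s) (hy : y.1.support ⊆ s) (hz : z.1.support ⊆ s) :
    (segmentClass ⟨s, hs, hx, hy⟩).trans (segmentClass ⟨s, hs, hy, hz⟩) =
      segmentClass ⟨s, hs, hx, hz⟩ := by
  refine Path.Homotopic.Quotient.eq.2 (homotopic_of_near fun t => ⟨s, hs, ?_, ?_⟩)
  · rw [Path.trans_apply]
    split_ifs
    exacts [support_segment_subset _ _ hx hy, support_segment_subset _ _ hy hz]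
  · exact support_segment_subset _ _ hx hz

theorem mk_eq_segmentClass_trans {x y z : X.Realization} (p : Path x y) (h : ∀ t, Near (p t) z)
    (hx : Near x z) (hy : Near z y) :
    Path.Homotopic.Quotient.mk p = (segmentClass hx).trans (segmentClass hy) := by
  -- Constant pieces synchronize the two paths: at each time `x` or `y` is compared with a point of
  -- a segment, or `p` with `z`.
  have key : ((Path.refl x).trans (p.trans (Path.refl y))).Homotopic
      ((segment hx).trans ((Path.refl z).trans (segment hy))) := by
    refine homotopic_of_near fun t => ?_
    simp only [Path.trans_apply]
    split_ifs
    · obtain ⟨s, hs, h1, h2⟩ := hx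
      exact ⟨s, hs, h1, support_segment_subset _ _ h1 h2⟩
    · exact h _
    · obtain ⟨s, hs, h1, h2⟩ := hy
      exact ⟨s, hs, h2, support_segment_subset _ _ h1 h2⟩
  simpa [segmentClass] using Path.Homotopic.Quotient.eq.2 key

/-- A vertex, as a point of the realization. -/
noncomputable def vertex (X : AbstractSimplicialComplex V) (v : V) : X.Realization :=
  ⟨Finsupp.single v 1, fun w => by
    classical
    rw [Finsupp.single_apply]
    split_ifs <;> norm_num, by simp, by
    rw [Finsupp.support_single _ one_ne_zero]
    exact X.singleton_mem v⟩

theorem support_vertex (v : V) : (vertex X v).1.support = {v} :=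
  Finsupp.support_single _ one_ne_zero

theorem support_vertex_subset {v : V} {s : Finset V} : (vertex X v).1.support ⊆ s ↔ v ∈ s := by
  rw [support_vertex, Finset.singleton_subset_iff]

theorem near_vertex_of_mem {x : X.Realization} {v : V} (hv : v ∈ x.1.support) :
    Near x (vertex X v) :=
  ⟨_, x.support_mem, subset_rfl, support_vertex_subset.2 hv⟩

/-- A homotopy class is standard if it contains a path that runs straight to a vertex, along two
edges, and straight to the end point. -/
def IsStandard {x y : X.Realization} (c : Path.Homotopic.Quotient x y) : Prop :=
  ∃ (u v w : V) (hu : u ∈ x.1.support) (hw : w ∈ y.1.support)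
    (huv : Near (vertex X u) (vertex X v)) (hvw : Near (vertex X v) (vertex X w)),
    c = (segmentClass (near_vertex_of_mem hu)).trans ((segmentClass huv).trans
      ((segmentClass hvw).trans (segmentClass (near_vertex_of_mem hw).symm)))

theorem isStandard_refl (x : X.Realization) : IsStandard (Path.Homotopic.Quotient.refl x) := by
  obtain ⟨u, hu⟩ := nonempty_of_mem x.support_mem
  refine ⟨u, u, u, hu, hu, Near.refl _, Near.refl _, ?_⟩
  rw [segmentClass_self, Path.Homotopic.Quotient.refl_trans, Path.Homotopic.Quotient.refl_trans,
    segmentClass_trans x.support_mem subset_rfl (support_vertex_subset.2 hu) subset_rfl]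
  exact (segmentClass_self _).symm

theorem segmentClass_vertex_trans {u v w : V} {s : Finset V} (h : s ∈ X) (hu : u ∈ s) (hv : v ∈ s)
    (hw : w ∈ s) (huv : Near (vertex X u) (vertex X v)) (hvw : Near (vertex X v) (vertex X w))
    (huw : Near (vertex X u) (vertex X w)) :
    (segmentClass huv).trans (segmentClass hvw) = segmentClass huw :=
  segmentClass_trans h (support_vertex_subset.2 hu) (support_vertex_subset.2 hv)
    (support_vertex_subset.2 hw)

variable [DecidableEq V]

theorem near_vertex_iff {u v : V} : Near (vertex X u) (vertex X v) ↔ {u, v} ∈ X := by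
  constructor
  · rintro ⟨s, hs, hu, hv⟩
    rw [support_vertex_subset] at hu hv
    exact mem_of_subset hs (by grind) (by simp)
  · intro h
    exact ⟨_, h, support_vertex_subset.2 (by simp), support_vertex_subset.2 (by simp)⟩

/-! ### Simple connectedness of ample complexes -/

section Ample

variable {r : ℕ}

/-- A cone vertex over `a, b, c, d` spans simplexes with all three edges. The trailing `k` allows
rewriting inside longer composites. -/
theorem exists_edge_trans_eq (hr : 4 ≤ r) (hX : X.IsAmple r) {a b c d : V}
    (hab : Near (vertex X a) (vertex X b)) (hbc : Near (vertex X b) (vertex X c))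
    (hcd : Near (vertex X c) (vertex X d)) :
    ∃ (z : V) (haz : Near (vertex X a) (vertex X z)) (hzd : Near (vertex X z) (vertex X d)),
      ∀ {y : X.Realization} (k : Path.Homotopic.Quotient (vertex X d) y),
      (segmentClass hab).trans ((segmentClass hbc).trans ((segmentClass hcd).trans k)) =
        (segmentClass haz).trans ((segmentClass hzd).trans k) := by
  obtain ⟨z, hz⟩ := hX.exists_cone (U := {a, b, c, d}) (Finset.card_le_four.trans hr)
  rw [near_vertex_iff] at hab hbc hcd
  have h1 := hz _ hab (by grind)
  have h2 := hz _ hbc (by grind)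
  have h3 := hz _ hcd (by grind)
  have near : ∀ {u v : V} {s : Finset V}, s ∈ X → u ∈ s → v ∈ s →
      Near (vertex X u) (vertex X v) := fun hs hu hv =>
    ⟨_, hs, support_vertex_subset.2 hu, support_vertex_subset.2 hv⟩
  have haz := near (u := a) (v := z) h1 (by simp) (by simp)
  have hzb := near (u := z) (v := b) h1 (by simp) (by simp)
  have hbz := near (u := b) (v := z) h1 (by simp) (by simp)
  have hzc := near (u := z) (v := c) h2 (by simp) (by simp)
  have hcz := near (u := c) (v := z) h2 (by simp) (by simp)
  have hzd := near (u := z) (v := d) h3 (by simp) (by simp)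
  refine ⟨z, haz, hzd, fun k => ?_⟩
  -- Each edge is rerouted through `z`; the backtracks from `z` to `b` and to `c` then cancel.
  rw [← segmentClass_vertex_trans (u := a) (v := z) (w := b) h1 (by simp) (by simp) (by simp)
        haz hzb,
    ← segmentClass_vertex_trans (u := b) (v := z) (w := c) h2 (by simp) (by simp) (by simp)
        hbz hzc,
    ← segmentClass_vertex_trans (u := c) (v := z) (w := d) h3 (by simp) (by simp) (by simp)
        hcz hzd]
  simp only [Path.Homotopic.Quotient.trans_assoc]
  rw [← Path.Homotopic.Quotient.trans_assoc (segmentClass hzb),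
    segmentClass_vertex_trans (u := z) (v := b) (w := z) h1 (by simp) (by simp) (by simp)
        hzb hbz
      (Near.refl _), segmentClass_self, Path.Homotopic.Quotient.refl_trans,
    ← Path.Homotopic.Quotient.trans_assoc (segmentClass hzc),
    segmentClass_vertex_trans (u := z) (v := c) (w := z) h2 (by simp) (by simp) (by simp)
        hzc hcz
      (Near.refl _), segmentClass_self, Path.Homotopic.Quotient.refl_trans]

/-- Both sides equal the composite through a cone vertex over the square. -/
theorem edge_trans_edge_eq (hr : 4 ≤ r) (hX : X.IsAmple r) {a b c d : V}
    (hab : Near (vertex X a) (vertex X b)) (hbd : Near (vertex X b) (vertex X d))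
    (hac : Near (vertex X a) (vertex X c)) (hcd : Near (vertex X c) (vertex X d)) :
    (segmentClass hab).trans (segmentClass hbd) = (segmentClass hac).trans (segmentClass hcd) := by
  obtain ⟨z, hz⟩ := hX.exists_cone (U := {a, b, c, d}) (Finset.card_le_four.trans hr)
  rw [near_vertex_iff] at hab hbd hac hcd
  have near : ∀ {u v : V} {s : Finset V}, s ∈ X → u ∈ s → v ∈ s →
      Near (vertex X u) (vertex X v) := fun hs hu hv =>
    ⟨_, hs, support_vertex_subset.2 hu, support_vertex_subset.2 hv⟩
  have key : ∀ e : V, (h1 : {a, e} ∈ X) → (h2 : {e, d} ∈ X) → e ∈ ({b, c} : Finset V) →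
      ∀ (haz : Near (vertex X a) (vertex X z)) (hzd : Near (vertex X z) (vertex X d)),
      (segmentClass (near_vertex_iff.2 h1)).trans (segmentClass (near_vertex_iff.2 h2)) =
        (segmentClass haz).trans (segmentClass hzd) := by
    intro e h1 h2 he haz hzd
    have h1' := hz _ h1 (by grind)
    have h2' := hz _ h2 (by grind)
    have hze := near (u := z) (v := e) h1' (by simp) (by simp)
    have hez := near (u := e) (v := z) h1' (by simp) (by simp)
    rw [← segmentClass_vertex_trans (u := a) (v := z) (w := e) h1' (by simp) (by simp) (by simp)
        haz hze,
      ← segmentClass_vertex_trans (u := e) (v := z) (w := d) h2' (by simp) (by simp) (by simp)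
        hez hzd]
    simp only [Path.Homotopic.Quotient.trans_assoc]
    rw [← Path.Homotopic.Quotient.trans_assoc (segmentClass hze),
      segmentClass_vertex_trans (u := z) (v := e) (w := z) h1' (by simp) (by simp) (by simp)
        hze hez
        (Near.refl _), segmentClass_self, Path.Homotopic.Quotient.refl_trans]
  have haz := near (u := a) (v := z) (hz _ hab (by grind)) (by simp) (by simp)
  have hzd := near (u := z) (v := d) (hz _ hcd (by grind)) (by simp) (by simp)
  exact (key b hab hbd (by simp) haz hzd).trans (key c hac hcd (by simp) haz hzd).symm

/-- The edges from `u'` to `u` and from `w` to `w'` lie in the supports of `x` and `y`. Adding them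
to the first edge path gives four edges from `u'` to `w'`; two shortenings leave two, to be compared
across a square. -/
theorem IsStandard.eq (hr : 4 ≤ r) (hX : X.IsAmple r) {x y : X.Realization}
    {c c' : Path.Homotopic.Quotient x y} (hc : IsStandard c) (hc' : IsStandard c') : c = c' := by
  obtain ⟨u, v, w, hu, hw, huv, hvw, rfl⟩ := hc
  obtain ⟨u', v', w', hu', hw', huv', hvw', rfl⟩ := hc'
  have huu : Near (vertex X u') (vertex X u) :=
    ⟨_, x.support_mem, support_vertex_subset.2 hu', support_vertex_subset.2 hu⟩
  have hww : Near (vertex X w) (vertex X w') :=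
    ⟨_, y.support_mem, support_vertex_subset.2 hw, support_vertex_subset.2 hw'⟩
  rw [← segmentClass_trans x.support_mem subset_rfl (support_vertex_subset.2 hu')
      (support_vertex_subset.2 hu),
    ← segmentClass_trans y.support_mem (support_vertex_subset.2 hw)
      (support_vertex_subset.2 hw') subset_rfl]
  obtain ⟨z, h1, h2, h⟩ := exists_edge_trans_eq hr hX huu huv hvw
  obtain ⟨z', h1', h2', h'⟩ := exists_edge_trans_eq hr hX h1 h2 hww
  simp only [Path.Homotopic.Quotient.trans_assoc]
  rw [h, h', ← Path.Homotopic.Quotient.trans_assoc (segmentClass h1'),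
    edge_trans_edge_eq hr hX h1' h2' huv' hvw', Path.Homotopic.Quotient.trans_assoc]

/-- Inside the open star of `v`, the path `p` may be replaced by going straight to `v` and out
again. This adds a third edge, from `w` to `v`, and three edges shorten to two. -/
theorem IsStandard.trans_mk (hr : 4 ≤ r) (hX : X.IsAmple r) {x y z : X.Realization}
    {c : Path.Homotopic.Quotient x y} (hc : IsStandard c) (p : Path y z) {v : V}
    (hv : ∀ t, v ∈ (p t).1.support) : IsStandard (c.trans (.mk p)) := by
  obtain ⟨a, b, w, ha, hw, hab, hbw, rfl⟩ := hc
  have hy : v ∈ y.1.support := by simpa using hv 0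
  have hz : v ∈ z.1.support := by simpa using hv 1
  have hwv : Near (vertex X w) (vertex X v) :=
    ⟨_, y.support_mem, support_vertex_subset.2 hw, support_vertex_subset.2 hy⟩
  obtain ⟨e, h1, h2, h⟩ := exists_edge_trans_eq hr hX hab hbw hwv
  refine ⟨a, e, v, ha, hz, h1, h2, ?_⟩
  rw [mk_eq_segmentClass_trans p (fun t => near_vertex_of_mem (hv t)) (near_vertex_of_mem hy)
    (near_vertex_of_mem hz).symm, ← h]
  simp only [Path.Homotopic.Quotient.trans_assoc]
  rw [← Path.Homotopic.Quotient.trans_assoc (segmentClass (near_vertex_of_mem hw).symm),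
    segmentClass_trans y.support_mem (support_vertex_subset.2 hw) subset_rfl
      (support_vertex_subset.2 hy)]

theorem isStandard_mk (hr : 4 ≤ r) (hX : X.IsAmple r) {x y : X.Realization} (p : Path x y) :
    IsStandard (.mk p) := by
  -- The cover consists of the preimages of the open vertex stars.
  obtain ⟨t, ht0, hmono, ⟨N, hN⟩, ht⟩ := exists_monotone_Icc_subset_open_cover_unitInterval
    (c := fun v : V => p ⁻¹' {x | 0 < x.1 v})
    (fun v => (isOpen_lt continuous_const (continuous_coord v)).preimage p.continuous)
    (fun s _ => by
      obtain ⟨v, hv⟩ := nonempty_of_mem (p s).support_mem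
      exact Set.mem_iUnion.2 ⟨v, lt_of_le_of_ne ((p s).coord_nonneg v)
        (Finsupp.mem_support_iff.1 hv).symm⟩)
  have key : ∀ n, IsStandard (.mk (p.subpath 0 (t n))) := by
    intro n
    induction n with
    | zero =>
      rw [ht0, Path.subpath_self]
      exact isStandard_refl _
    | succ n ih =>
      obtain ⟨v, hv⟩ := ht n
      rw [← Path.Homotopic.Quotient.eq.2 ⟨Path.Homotopy.subpathTransSubpath p 0 (t n) (t (n + 1))⟩]
      refine ih.trans_mk hr hX _ (v := v) fun s => ?_
      have hs : p.subpath (t n) (t (n + 1)) s ∈ p '' Set.Icc (t n) (t (n + 1)) := by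
        rw [← Path.range_subpath_of_le p _ _ (hmono n.le_succ)]
        exact ⟨s, rfl⟩
      obtain ⟨s', hs', h⟩ := hs
      rw [← h]
      exact Finsupp.mem_support_iff.2 (hv hs').ne'
  have h1 := key N
  rw [hN N le_rfl, Path.subpath_zero_one] at h1
  have cast : ∀ {x' y' : X.Realization} (hx : x' = x) (hy : y' = y),
      IsStandard (.mk (p.cast hx hy)) → IsStandard (.mk p) := by
    rintro _ _ rfl rfl h
    exact h
  exact cast _ _ h1

theorem simplyConnectedSpace_of_isAmple (hr : 4 ≤ r) (hX : X.IsAmple r) :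
    SimplyConnectedSpace X.Realization := by
  rw [simply_connected_iff_paths_homotopic']
  refine ⟨⟨hX.1.map (vertex X), fun x y => ?_⟩, fun p q => Path.Homotopic.Quotient.eq.1
    ((isStandard_mk hr hX p).eq hr hX (isStandard_mk hr hX q))⟩
  obtain ⟨u, hu⟩ := nonempty_of_mem x.support_mem
  obtain ⟨w, hw⟩ := nonempty_of_mem y.support_mem
  obtain ⟨v, hv⟩ := hX.exists_cone (U := {u, w}) (Finset.card_le_two.trans (by lia))
  have h1 := hv _ (X.singleton_mem u) (by simp)
  have h2 := hv _ (X.singleton_mem w) (by simp)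
  exact ⟨(segment (near_vertex_of_mem hu)).trans ((segment (near_vertex_iff.2 h1).symm).trans
    ((segment (near_vertex_iff.2 h2)).trans (segment (near_vertex_of_mem hw).symm)))⟩

end Ample

end Realization

/-- The stellar subdivision of `K` at the face `s`, with new vertex `none`. -/
def stellar {V : Type*} (K : AbstractSimplicialComplex V) (s : Finset V) (hs : s ∈ K)
    (h2 : 1 < s.card) : AbstractSimplicialComplex (Option V) where
  faces := {t | t.Nonempty ∧ ¬ s ⊆ t.eraseNone ∧
    ∃ u ∈ K, t.eraseNone ⊆ u ∧ (none ∈ t → s ⊆ u)}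
  isRelLowerSet_faces := by
    rintro t ⟨ht, hst, u, hu, htu, h⟩
    exact ⟨ht, fun t' htt ht' => ⟨ht', fun h' => hst (h'.trans (Finset.eraseNone.monotone htt)),
      u, hu, (Finset.eraseNone.monotone htt).trans htu, fun h' => h (htt h')⟩⟩
  singleton_mem v := by
    -- Subdividing at a single vertex would delete that vertex; this is where `1 < s.card` is
    -- needed.
    have key : ∀ t : Finset V, t.card ≤ 1 → ¬ s ⊆ t := fun t ht h => by
      have := Finset.card_le_card h
      lia
    rcases v with _ | v
    · exact ⟨by simp, key _ (by simp), s, hs, by simp, fun _ => subset_rfl⟩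
    · refine ⟨by simp, key _ ((Finset.card_le_card (t := {v}) fun w hw => ?_).trans (by simp)),
        {v}, K.singleton_mem v,
        fun w hw => by simpa using hw, by simp⟩
      simpa using hw

/-! ### The realization of a stellar subdivision -/

section Stellar

variable {V : Type*} {K : AbstractSimplicialComplex V} {s : Finset V} {hs : s ∈ K}
  {h2 : 1 < s.card}

theorem mem_stellar {t : Finset (Option V)} : t ∈ K.stellar s hs h2 ↔ t.Nonempty ∧
    ¬ s ⊆ t.eraseNone ∧ ∃ u ∈ K, t.eraseNone ⊆ u ∧ (none ∈ t → s ⊆ u) := Iff.rfl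

open Realization

open Classical in
/-- The barycentric coordinates in `K` of a point of the stellar subdivision. -/
noncomputable def stellarCoord (s : Finset V) (x : Option V →₀ ℝ) (v : V) : ℝ :=
  x (some v) + if v ∈ s then x none / s.card else 0

theorem stellarCoord_nonneg (x : (K.stellar s hs h2).Realization) (v : V) :
    0 ≤ stellarCoord s x.1 v := by
  unfold stellarCoord
  refine add_nonneg (x.coord_nonneg _) ?_
  split_ifs
  exacts [div_nonneg (x.coord_nonneg _) (Nat.cast_nonneg _), le_rfl]

theorem stellarCoord_ne_zero_iff (x : (K.stellar s hs h2).Realization) (v : V) :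
    stellarCoord s x.1 v ≠ 0 ↔ some v ∈ x.1.support ∨ none ∈ x.1.support ∧ v ∈ s := by
  have h1 := x.coord_nonneg (some v)
  have h3 := x.coord_nonneg none
  have h4 : (0 : ℝ) < s.card := by exact_mod_cast (by lia : 0 < s.card)
  have h5 : 0 ≤ x.1 none / s.card := div_nonneg h3 h4.le
  rw [Finsupp.mem_support_iff, Finsupp.mem_support_iff]
  unfold stellarCoord
  split_ifs with h
  · rw [ne_eq, add_eq_zero_iff_of_nonneg h1 h5, div_eq_zero_iff]
    simp only [h4.ne', or_false, h, and_true]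
    tauto
  · simp [h]

theorem sum_stellarCoord (x : (K.stellar s hs h2).Realization) {u : Finset V}
    (hu : x.1.support.eraseNone ⊆ u) (hsu : none ∈ x.1.support → s ⊆ u) :
    ∑ v ∈ u, stellarCoord s x.1 v = 1 := by
  classical
  have h4 : (s.card : ℝ) ≠ 0 := by exact_mod_cast (by lia : s.card ≠ 0)
  have h1 : x.1.support ⊆ Finset.insertNone u := by
    intro v hv
    rcases v with _ | v
    · simp
    · simpa using hu (Finset.mem_eraseNone.2 hv)
  refine Eq.trans ?_ (x.sum_eq_one h1)
  rw [Finset.sum_insertNone, add_comm]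
  unfold stellarCoord
  rw [Finset.sum_add_distrib, ← Finset.sum_filter]
  congr 1
  by_cases h : none ∈ x.1.support
  · rw [Finset.filter_mem_eq_inter, Finset.inter_eq_right.2 (hsu h), Finset.sum_const,
      nsmul_eq_mul, mul_div_cancel₀ _ h4]
  · rw [Finsupp.notMem_support_iff] at h
    simp [h]

/-- The linear map from the stellar subdivision to `K` sending the new vertex to the barycenter
of `s`. -/
noncomputable def stellarMap (x : (K.stellar s hs h2).Realization) : K.Realization :=
  ofFace (mem_stellar.1 x.support_mem).2.2.choose_spec.1 (stellarCoord s x.1)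
    (stellarCoord_nonneg x)
    (fun v hv => by
      have h := (mem_stellar.1 x.support_mem).2.2.choose_spec.2
      rcases (stellarCoord_ne_zero_iff x v).1 hv with h' | h'
      · exact h.1 (Finset.mem_eraseNone.2 h')
      · exact h.2 h'.1 h'.2)
    (sum_stellarCoord x (mem_stellar.1 x.support_mem).2.2.choose_spec.2.1
      (mem_stellar.1 x.support_mem).2.2.choose_spec.2.2)

theorem stellarMap_apply (x : (K.stellar s hs h2).Realization) (v : V) :
    (stellarMap x).1 v = stellarCoord s x.1 v := rfl

theorem mem_support_stellarMap (x : (K.stellar s hs h2).Realization) (v : V) :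
    v ∈ (stellarMap x).1.support ↔ some v ∈ x.1.support ∨ none ∈ x.1.support ∧ v ∈ s := by
  rw [Finsupp.mem_support_iff, stellarMap_apply, stellarCoord_ne_zero_iff]

/-- Consequently the coordinate at `none` is `s.card` times the least coordinate on `s` of the image
point, which gives injectivity. -/
theorem exists_coord_some_eq_zero (x : (K.stellar s hs h2).Realization) :
    ∃ v ∈ s, x.1 (some v) = 0 := by
  obtain ⟨v, hv, hv'⟩ := Finset.not_subset.1 (mem_stellar.1 x.support_mem).2.1
  exact ⟨v, hv, by simpa using hv'⟩

theorem injective_stellarMap :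
    Function.Injective (stellarMap : (K.stellar s hs h2).Realization → K.Realization) := by
  have h4 : (0 : ℝ) < s.card := by exact_mod_cast (by lia : 0 < s.card)
  have key : ∀ x y : (K.stellar s hs h2).Realization, stellarMap x = stellarMap y →
      y.1 none ≤ x.1 none := by
    intro x y h
    obtain ⟨v, hv, hv0⟩ := exists_coord_some_eq_zero x
    have h' : stellarCoord s x.1 v = stellarCoord s y.1 v := by
      rw [← stellarMap_apply, h, stellarMap_apply]
    simp only [stellarCoord, hv, hv0, if_true, zero_add] at h'
    have := y.coord_nonneg (some v)
    exact (div_le_div_iff_of_pos_right h4).1 (by linarith)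
  intro x y h
  have h0 : x.1 none = y.1 none := le_antisymm (key y x h.symm) (key x y h)
  refine ext_coord fun v => ?_
  rcases v with _ | v
  · exact h0
  · have h' : stellarCoord s x.1 v = stellarCoord s y.1 v := by
      rw [← stellarMap_apply, h, stellarMap_apply]
    simpa [stellarCoord, h0] using h'

theorem surjective_stellarMap :
    Function.Surjective (stellarMap : (K.stellar s hs h2).Realization → K.Realization) := by
  classical
  intro y
  have h4 : (0 : ℝ) < s.card := by exact_mod_cast (by lia : 0 < s.card)
  have hne : s.Nonempty := nonempty_of_mem hs
  -- The preimage subtracts the minimum over `s` and gives `s.card` times it to `none`. The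
  -- coordinate at `w` becomes zero, so the support does not contain `s`.
  obtain ⟨w, hw, hmin⟩ := s.exists_min_image y.1 hne
  have hw0 := y.coord_nonneg w
  let g : Option V → ℝ := fun o => o.elim (s.card * y.1 w)
    fun v => y.1 v - if v ∈ s then y.1 w else 0
  have g0 : ∀ o, 0 ≤ g o := by
    rintro (_ | v)
    · exact mul_nonneg h4.le hw0
    · by_cases hv : v ∈ s
      · simpa [g, hv] using hmin v hv
      · simpa [g, hv] using y.coord_nonneg v
  have gsupp : ∀ v, g (some v) ≠ 0 → v ∈ y.1.support := by
    intro v hv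
    rw [Finsupp.mem_support_iff]
    intro h
    by_cases hvs : v ∈ s
    · have := hmin v hvs
      have : y.1 w = 0 := le_antisymm (by linarith) hw0
      simp [g, h, this] at hv
    · simp [g, h, hvs] at hv
  have gnone : g none ≠ 0 → s ⊆ y.1.support := by
    intro h v hv
    rw [Finsupp.mem_support_iff]
    intro h'
    have := hmin v hv
    have : y.1 w = 0 := le_antisymm (by linarith) hw0
    simp [g, this] at h
  let t : Finset (Option V) := (Finset.insertNone y.1.support).filter fun o => g o ≠ 0
  have gt : ∀ o, g o ≠ 0 → o ∈ t := by
    rintro (_ | v) h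
    · simp [t, h]
    · simp only [t, Finset.mem_filter, Finset.some_mem_insertNone]
      exact ⟨gsupp v h, h⟩
  have ht : t ∈ K.stellar s hs h2 := by
    refine mem_stellar.2 ⟨?_, ?_, _, y.support_mem, ?_, ?_⟩
    · obtain ⟨v, hv⟩ := nonempty_of_mem y.support_mem
      rw [Finsupp.mem_support_iff] at hv
      by_cases h : y.1 w = 0
      · exact ⟨some v, gt _ (by simpa [g, h] using hv)⟩
      · exact ⟨none, gt _ (mul_ne_zero h4.ne' h)⟩
    · intro h
      have := h hw
      simp [t, g, hw] at this
    · intro v hv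
      simp only [t, Finset.mem_eraseNone, Finset.mem_filter] at hv
      exact gsupp v hv.2
    · intro h
      simp only [t, Finset.mem_filter] at h
      exact gnone h.2
  have hfix : ∀ v, g (some v) + (if v ∈ s then g none / s.card else 0) = y.1 v := by
    intro v
    have : g none / s.card = y.1 w := by simp [g, h4.ne']
    rw [this]
    simp [g]
  have g1 : ∑ o ∈ t, g o = 1 := by
    refine Eq.trans ?_ (y.sum_eq_one subset_rfl)
    rw [Finset.sum_filter_ne_zero, Finset.sum_insertNone, add_comm]
    rw [← Finset.sum_congr rfl fun v _ => hfix v, Finset.sum_add_distrib, ← Finset.sum_filter]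
    congr 1
    by_cases h : g none = 0
    · simp [h]
    · rw [Finset.filter_mem_eq_inter, Finset.inter_eq_right.2 (gnone h), Finset.sum_const,
        nsmul_eq_mul, mul_div_cancel₀ _ h4.ne']
  refine ⟨ofFace ht g g0 gt g1, ext_coord fun v => ?_⟩
  rw [stellarMap_apply, stellarCoord, ofFace_apply, ofFace_apply]
  exact hfix v

theorem continuous_stellarMap [Finite V] :
    Continuous (stellarMap : (K.stellar s hs h2).Realization → K.Realization) := by
  have := Fintype.ofFinite V
  refine continuous_of_coord Finset.univ (fun _ => Finset.subset_univ _) fun v => ?_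
  simp only [stellarMap_apply, stellarCoord]
  refine (continuous_coord _).add ?_
  split_ifs
  exacts [(continuous_coord _).div_const _, continuous_const]

/-- The realization of a finite complex is homeomorphic to that of a stellar subdivision. -/
noncomputable def stellarHomeomorph [Finite V] (K : AbstractSimplicialComplex V) (s : Finset V)
    (hs : s ∈ K) (h2 : 1 < s.card) : (K.stellar s hs h2).Realization ≃ₜ K.Realization :=
  Continuous.homeoOfEquivCompactToT2
    (f := Equiv.ofBijective stellarMap ⟨injective_stellarMap, surjective_stellarMap⟩)
    continuous_stellarMap

theorem stellarHomeomorph_apply [Finite V] (x : (K.stellar s hs h2).Realization) :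
    stellarHomeomorph K s hs h2 x = stellarMap x := rfl

end Stellar

/-! ### The triangle as a disc -/

section Triangle

open Realization

/-- A full triangle is homeomorphic to the unit disc, with the proper faces going to the circle. -/
theorem exists_homeomorph_triangle :
    ∃ h : (⊤ : AbstractSimplicialComplex (Fin 3)).Realization ≃ₜ
        Metric.closedBall (0 : EuclideanSpace ℝ (Fin 2)) 1,
      ∀ x, (h x : EuclideanSpace ℝ (Fin 2)) ∈ Metric.sphere (0 : EuclideanSpace ℝ (Fin 2)) 1 ↔
        ∃ i, x.1 i = 0 := by
  -- Two barycentric coordinates place the triangle in the plane as a bounded convex set with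
  -- nonempty interior.
  let T : Set (EuclideanSpace ℝ (Fin 2)) := {p | 0 ≤ p 0 ∧ 0 ≤ p 1 ∧ p 0 + p 1 ≤ 1}
  let T' : Set (EuclideanSpace ℝ (Fin 2)) := {p | 0 < p 0 ∧ 0 < p 1 ∧ p 0 + p 1 < 1}
  have c0 : Continuous fun p : EuclideanSpace ℝ (Fin 2) => p 0 := by fun_prop
  have c1 : Continuous fun p : EuclideanSpace ℝ (Fin 2) => p 1 := by fun_prop
  have hclosed : IsClosed T := (isClosed_le continuous_const c0).inter
    ((isClosed_le continuous_const c1).inter (isClosed_le (c0.add c1) continuous_const))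
  have hopen : IsOpen T' := (isOpen_lt continuous_const c0).inter
    ((isOpen_lt continuous_const c1).inter (isOpen_lt (c0.add c1) continuous_const))
  have hconv : Convex ℝ T := by
    rintro p ⟨h1, h2, h3⟩ q ⟨h4, h5, h6⟩ a b ha hb hab
    refine ⟨?_, ?_, ?_⟩ <;> simp only [PiLp.add_apply, PiLp.smul_apply, smul_eq_mul]
    · positivity
    · positivity
    · nlinarith
  have hbdd : Bornology.IsBounded T := by
    refine (Metric.isBounded_closedBall (x := (0 : EuclideanSpace ℝ (Fin 2))) (r := 2)).subset ?_
    rintro p ⟨h1, h2, h3⟩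
    rw [mem_closedBall_zero_iff, EuclideanSpace.norm_eq, Real.sqrt_le_left (by norm_num)]
    simp only [Fin.sum_univ_two, Real.norm_eq_abs, sq_abs]
    nlinarith
  have hint : interior T = T' := by
    refine subset_antisymm ?_ (interior_maximal (fun p hp => ⟨hp.1.le, hp.2.1.le, hp.2.2.le⟩) hopen)
    -- An interior point can move a little in the direction that tightens a given inequality, so the
    -- inequality was strict.
    have key : ∀ d p : EuclideanSpace ℝ (Fin 2), p ∈ interior T →
        ∃ ε : ℝ, 0 < ε ∧ p + ε • d ∈ T := by
      intro d p hp
      have hc : Continuous fun ε : ℝ => p + ε • d := by fun_prop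
      have hn : ∀ᶠ ε in 𝓝 (0 : ℝ), p + ε • d ∈ T := by
        refine hc.continuousAt.eventually_mem ?_
        simpa using mem_interior_iff_mem_nhds.1 hp
      obtain ⟨δ, hδ, h⟩ := Metric.eventually_nhds_iff.1 hn
      exact ⟨δ / 2, by positivity, h (by simp [abs_of_pos hδ, hδ])⟩
    intro p hp
    obtain ⟨ε, hε, h1⟩ := key !₂[-1, 0] p hp
    obtain ⟨ε', hε', h2⟩ := key !₂[0, -1] p hp
    obtain ⟨ε'', hε'', h3⟩ := key !₂[1, 0] p hp
    refine ⟨?_, ?_, ?_⟩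
    · have := h1.1
      simp at this
      linarith
    · have := h2.2.1
      simp at this
      linarith
    · have := h3.2.2
      simp at this
      linarith
  have hne : (interior T).Nonempty := by
    rw [hint]
    refine ⟨!₂[1 / 4, 1 / 4], ?_⟩
    norm_num [T']
  obtain ⟨e, -, he, hfr⟩ :=
    exists_homeomorph_image_interior_closure_frontier_eq_unitBall hconv hne hbdd
  rw [hclosed.closure_eq] at he
  rw [hclosed.frontier_eq, hint] at hfr
  have hsum : ∀ x : (⊤ : AbstractSimplicialComplex (Fin 3)).Realization,
      x.1 0 + x.1 1 + x.1 2 = 1 := fun x => by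
    simpa [Fin.sum_univ_three] using x.sum_eq_one (Finset.subset_univ _)
  let φ : (⊤ : AbstractSimplicialComplex (Fin 3)).Realization →
      Metric.closedBall (0 : EuclideanSpace ℝ (Fin 2)) 1 :=
    fun x => ⟨e !₂[x.1 0, x.1 1], by
      rw [← he]
      refine ⟨_, ⟨?_, ?_, ?_⟩, rfl⟩
      · simpa using x.coord_nonneg 0
      · simpa using x.coord_nonneg 1
      · have := hsum x
        have := x.coord_nonneg 2
        simp
        linarith⟩
  have hφ : Continuous φ := by
    refine Continuous.subtype_mk (e.continuous.comp ?_) _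
    refine (PiLp.continuous_toLp 2 _).comp (continuous_pi fun i => ?_)
    fin_cases i
    exacts [continuous_coord 0, continuous_coord 1]
  have hinj : Function.Injective φ := by
    intro x y h
    have h' := e.injective (Subtype.ext_iff.1 h)
    have h0 : x.1 0 = y.1 0 := by simpa using congrArg (fun p : EuclideanSpace ℝ (Fin 2) => p 0) h'
    have h1 : x.1 1 = y.1 1 := by simpa using congrArg (fun p : EuclideanSpace ℝ (Fin 2) => p 1) h'
    have hx := hsum x
    have hy := hsum y
    refine ext_coord fun i => ?_
    fin_cases i
    · exact h0
    · exact h1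
    · change x.1 2 = y.1 2
      linarith
  have hsurj : Function.Surjective φ := by
    rintro ⟨q, hq⟩
    rw [← he] at hq
    obtain ⟨p, ⟨h1, h2, h3⟩, rfl⟩ := hq
    refine ⟨ofFace (s := Finset.univ) (by exact Finset.univ_nonempty)
      ![p 0, p 1, 1 - p 0 - p 1] ?_ (by simp) ?_, ?_⟩
    · intro i
      fin_cases i
      · exact h1
      · exact h2
      · change 0 ≤ 1 - p 0 - p 1
        linarith
    · rw [Fin.sum_univ_three]
      simp
    · refine Subtype.ext (congrArg e ?_)
      ext i
      fin_cases i <;> rfl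
  refine ⟨Continuous.homeoOfEquivCompactToT2 (f := Equiv.ofBijective φ ⟨hinj, hsurj⟩) hφ,
    fun x => ?_⟩
  change e !₂[x.1 0, x.1 1] ∈ _ ↔ _
  rw [← hfr, e.injective.mem_set_image]
  have h0 := x.coord_nonneg 0
  have h1 := x.coord_nonneg 1
  have h2 := x.coord_nonneg 2
  have hs := hsum x
  have hT : (!₂[x.1 0, x.1 1] : EuclideanSpace ℝ (Fin 2)) ∈ T :=
    ⟨by simpa, by simpa, by simp; linarith⟩
  have hT' : (!₂[x.1 0, x.1 1] : EuclideanSpace ℝ (Fin 2)) ∈ T' ↔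
      0 < x.1 0 ∧ 0 < x.1 1 ∧ x.1 0 + x.1 1 < 1 := by
    simp [T']
  rw [Set.mem_sdiff, hT']
  simp only [hT, true_and]
  constructor
  · intro h
    by_contra! h'
    exact h ⟨lt_of_le_of_ne h0 (h' 0).symm, lt_of_le_of_ne h1 (h' 1).symm, by
      have := lt_of_le_of_ne h2 (h' 2).symm
      linarith⟩
  · rintro ⟨i, hi⟩ ⟨h3, h4, h5⟩
    fin_cases i
    · exact h3.ne' hi
    · exact h4.ne' hi
    · have : x.1 2 = 0 := hi
      linarith

end Triangle

/-! ### Partial fillings and their subdivisions -/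

open Realization

/-- A set of vertices lies in one of the edges of the closed polygon `b 0, …, b m`. -/
def InPolygonEdge {W : Type*} (m : ℕ) (b : ℕ → W) (t : Finset W) : Prop :=
  (∃ i < m, ∀ w ∈ t, w = b i ∨ w = b (i + 1)) ∨ ∀ w ∈ t, w = b 0 ∨ w = b m

/-- The vertices `p`, `q`, `r` lie in a common face. -/
def Joint {V : Type*} (Y : AbstractSimplicialComplex V) (p q r : V) : Prop :=
  ∃ u ∈ Y, p ∈ u ∧ q ∈ u ∧ r ∈ u

/-- `D` is a triangulated disc with boundary polygon `b 0, …, b m`, at most `k` interior vertices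
and at most `2 k + m - 1` triangles. The boundary edge from `b m` to `b 0` lies in a unique
triangle, whose third vertex is `y`, and `β` is simplicial away from that edge. -/
structure IsPartialFilling {V W : Type*} [DecidableEq W] (Y : AbstractSimplicialComplex V)
    (m k : ℕ) (D : AbstractSimplicialComplex W) (b : ℕ → W) (y : W) (β : W → V) : Prop where
  two_le : 2 ≤ m
  inj : ∀ i ≤ m, ∀ j ≤ m, b i = b j → i = j
  edge_mem : ∀ i < m, {b i, b (i + 1)} ∈ D
  triangle_mem : {b 0, b m, y} ∈ D
  ne_zero : y ≠ b 0
  ne_last : y ≠ b m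
  subset_triangle : ∀ t ∈ D, b 0 ∈ t → b m ∈ t → t ⊆ {b 0, b m, y}
  exists_homeomorph : ∃ h : D.Realization ≃ₜ Metric.closedBall (0 : EuclideanSpace ℝ (Fin 2)) 1,
    ∀ x, (h x : EuclideanSpace ℝ (Fin 2)) ∈ Metric.sphere (0 : EuclideanSpace ℝ (Fin 2)) 1 ↔
      InPolygonEdge m b x.1.support
  simplicial : ∀ t ∈ D, ¬ (b 0 ∈ t ∧ b m ∈ t) → ∃ u ∈ Y, ∀ w ∈ t, β w ∈ u
  interior_le : {w | ∀ i ≤ m, b i ≠ w}.ncard ≤ k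
  triangles_le : {t | t ∈ D ∧ t.card = 3}.ncard + 1 ≤ 2 * k + m

namespace IsPartialFilling

variable {V W : Type*} [DecidableEq W] {Y : AbstractSimplicialComplex V} {m k : ℕ}
  {D : AbstractSimplicialComplex W} {b : ℕ → W} {y : W} {β : W → V}

theorem zero_ne_last (h : IsPartialFilling Y m k D b y β) : b 0 ≠ b m := fun h' => by
  have := h.inj 0 (by lia) m le_rfl h'
  have := h.two_le
  lia

theorem card_triangle (h : IsPartialFilling Y m k D b y β) :
    ({b 0, b m, y} : Finset W).card = 3 :=
  Finset.card_eq_three.2 ⟨_, _, _, h.zero_ne_last, h.ne_zero.symm, h.ne_last.symm, rfl⟩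

theorem card_edge (h : IsPartialFilling Y m k D b y β) : ({b 0, b m} : Finset W).card = 2 :=
  Finset.card_pair h.zero_ne_last

theorem closing_edge_mem (h : IsPartialFilling Y m k D b y β) : {b 0, b m} ∈ D :=
  mem_of_subset h.triangle_mem (by grind) (by simp)

theorem map_some_eraseNone {t : Finset (Option W)} (h : none ∉ t) :
    t.eraseNone.map Function.Embedding.some = t := by
  rw [Finset.map_some_eraseNone, Finset.erase_eq_of_notMem h]

theorem insertNone_eraseNone {t : Finset (Option W)} (h : none ∈ t) :
    Finset.insertNone t.eraseNone = t := by
  rw [Finset.insertNone_eraseNone, Finset.insert_eq_of_mem h]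

/-- Counting the triangles of a stellar subdivision. -/
theorem ncard_triangles_stellar_le [Finite W] {s τ : Finset W} (hs : s ∈ D) (h2 : 1 < s.card)
    (hτ : τ ∈ D) (hτ3 : τ.card = 3) (hsτ : s ⊆ τ) (hτs : ∀ t ∈ D, s ⊆ t → t ⊆ τ) :
    {t | t ∈ D.stellar s hs h2 ∧ t.card = 3}.ncard + 1 ≤ {t | t ∈ D ∧ t.card = 3}.ncard +
      ((τ.powersetCard 2).filter fun t => ¬ s ⊆ t).card := by
  have hfin : ({t | t ∈ D ∧ t.card = 3} : Set (Finset W)).Finite := Set.toFinite _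
  -- A triangle without `none` is an old one other than `τ`; a triangle at `none` is a cone on an
  -- edge of `τ` not containing `s`.
  have hsub : {t | t ∈ D.stellar s hs h2 ∧ t.card = 3} ⊆
      (fun t : Finset W => t.map Function.Embedding.some) '' ({t | t ∈ D ∧ t.card = 3} \ {τ}) ∪
      (fun t : Finset W => Finset.insertNone t) ''
        ((τ.powersetCard 2).filter fun t => ¬ s ⊆ t : Finset (Finset W)) := by
    rintro t ⟨ht, h3⟩
    obtain ⟨hne, hst, u, hu, htu, hsu⟩ := mem_stellar.1 ht
    by_cases hn : none ∈ t
    · right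
      have h' := insertNone_eraseNone hn
      refine ⟨t.eraseNone, ?_, h'⟩
      have hc := congrArg Finset.card h'
      rw [Finset.card_insertNone, h3] at hc
      simp only [Finset.coe_filter, Finset.mem_powersetCard]
      exact ⟨⟨htu.trans (hτs u hu (hsu hn)), by lia⟩, hst⟩
    · left
      have h' := map_some_eraseNone hn
      have hc := congrArg Finset.card h'
      rw [Finset.card_map, h3] at hc
      refine ⟨t.eraseNone, ⟨⟨mem_of_subset hu htu (Finset.card_pos.1 (by lia)), hc⟩, ?_⟩, h'⟩
      rintro h
      rw [Set.mem_singleton_iff] at h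
      exact hst (h ▸ hsτ)
  have h1 := Set.ncard_le_ncard hsub (Set.toFinite _)
  have h3 := Set.ncard_union_le
    ((fun t : Finset W => t.map Function.Embedding.some) '' ({t | t ∈ D ∧ t.card = 3} \ {τ}))
    ((fun t : Finset W => Finset.insertNone t) ''
        ((τ.powersetCard 2).filter fun t => ¬ s ⊆ t : Finset (Finset W)))
  have h4 := Set.ncard_image_le (f := fun t : Finset W => t.map Function.Embedding.some)
    (s := {t | t ∈ D ∧ t.card = 3} \ {τ}) (Set.toFinite _)
  have h5 := Set.ncard_image_le (f := fun t : Finset W => Finset.insertNone t)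
    (s := ((τ.powersetCard 2).filter fun t => ¬ s ⊆ t : Finset (Finset W))) (Set.toFinite _)
  rw [Set.ncard_coe_finset] at h5
  have h6 := Set.ncard_sdiff_singleton_add_one (s := {t | t ∈ D ∧ t.card = 3})
    (a := τ) ⟨hτ, hτ3⟩ hfin
  lia

/-- Subdivide the triangle at the closing edge by a new interior vertex. -/
theorem subdivide_triangle [Finite W] (h : IsPartialFilling Y m k D b y β) {v : V}
    (h0 : Y.Joint (β (b 0)) (β y) v) (hm : Y.Joint (β (b m)) (β y) v) :
    IsPartialFilling Y m (k + 1)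
      (D.stellar {b 0, b m, y} h.triangle_mem (by rw [h.card_triangle]; norm_num))
      (fun i => some (b i)) none (fun o => o.elim v β) where
  two_le := h.two_le
  inj i hi j hj hij := h.inj i hi j hj (Option.some_injective _ hij)
  edge_mem i hi := by
    refine mem_stellar.2 ⟨by simp, fun hs => ?_, _, h.edge_mem i hi, ?_, by simp⟩
    · have hle : ({b 0, b m, y} : Finset W) ⊆ {b i, b (i + 1)} :=
        hs.trans fun w hw => by simpa using hw
      have := Finset.card_le_card hle
      rw [h.card_triangle] at this
      have := Finset.card_le_two (a := b i) (b := b (i + 1))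
      lia
    · exact fun w hw => by simpa using hw
  triangle_mem := by
    refine mem_stellar.2 ⟨by simp, fun hs => ?_, _, h.triangle_mem, ?_, fun _ => subset_rfl⟩
    · have := hs (show y ∈ ({b 0, b m, y} : Finset W) by simp)
      simp [h.ne_zero, h.ne_last] at this
    · intro w hw
      simp only [Finset.mem_eraseNone, Finset.mem_insert, Option.some.injEq,
        Finset.mem_singleton, reduceCtorEq, or_false] at hw
      grind
  ne_zero := by simp
  ne_last := by simp
  subset_triangle t ht h0 hm := by
    obtain ⟨hne, hst, u, hu, htu, hsu⟩ := mem_stellar.1 ht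
    rw [← Finset.mem_eraseNone] at h0 hm
    have hu' := h.subset_triangle u hu (htu h0) (htu hm)
    rintro (_ | w) hw
    · simp
    · rw [← Finset.mem_eraseNone] at hw
      have := hu' (htu hw)
      have hwy : w ≠ y := by
        rintro rfl
        exact hst (by grind)
      grind
  exists_homeomorph := by
    obtain ⟨e, he⟩ := h.exists_homeomorph
    refine ⟨(stellarHomeomorph ..).trans e, fun x => ?_⟩
    rw [Homeomorph.trans_apply, he, stellarHomeomorph_apply]
    simp only [InPolygonEdge, mem_support_stellarMap]
    -- If `none` is in the support, the image has three distinct vertices in its support and lies on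
    -- no edge.
    have key : ∀ p q : W, (∀ w, some w ∈ x.1.support ∨
        none ∈ x.1.support ∧ w ∈ ({b 0, b m, y} : Finset W) → w = p ∨ w = q) ↔
        ∀ o ∈ x.1.support, o = some p ∨ o = some q := by
      intro p q
      constructor
      · rintro h' (_ | w) hw
        · exfalso
          have hle : ({b 0, b m, y} : Finset W) ⊆ {p, q} := fun w hw' => by
            simpa using h' w (Or.inr ⟨hw, hw'⟩)
          have := Finset.card_le_card hle
          rw [h.card_triangle] at this
          have := Finset.card_le_two (a := p) (b := q)
          lia
        · simpa using h' w (Or.inl hw)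
      · rintro h' w (hw | ⟨hw, -⟩)
        · simpa using h' _ hw
        · simpa using h' _ hw
    simp only [key]
  simplicial t ht hn := by
    obtain ⟨hne, hst, u, hu, htu, hsu⟩ := mem_stellar.1 ht
    rw [← Finset.mem_eraseNone, ← Finset.mem_eraseNone] at hn
    by_cases hnone : none ∈ t
    · have hsu := hsu hnone
      have hut := h.subset_triangle u hu (hsu (by simp)) (hsu (by simp))
      obtain ⟨u0, hu0, h1, h2, h3⟩ := h0
      obtain ⟨u1, hu1, h4, h5, h6⟩ := hm
      -- A face at `none` off the closing edge misses `b m` or `b 0`, and its image lies in the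
      -- simplex of `h0` or `hm` accordingly.
      by_cases hb : b 0 ∈ t.eraseNone
      · refine ⟨u0, hu0, ?_⟩
        rintro (_ | w) hw
        · exact h3
        · rw [← Finset.mem_eraseNone] at hw
          have := hut (htu hw)
          simp only [Finset.mem_insert, Finset.mem_singleton] at this
          rcases this with rfl | rfl | rfl
          · exact h1
          · exact absurd ⟨hb, hw⟩ hn
          · exact h2
      · refine ⟨u1, hu1, ?_⟩
        rintro (_ | w) hw
        · exact h6
        · rw [← Finset.mem_eraseNone] at hw
          have := hut (htu hw)
          simp only [Finset.mem_insert, Finset.mem_singleton] at this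
          rcases this with rfl | rfl | rfl
          · exact absurd hw hb
          · exact h4
          · exact h5
    · rw [← map_some_eraseNone hnone, Finset.map_nonempty] at hne
      obtain ⟨u', hu', hβ⟩ := h.simplicial t.eraseNone (mem_of_subset hu htu hne) hn
      refine ⟨u', hu', ?_⟩
      rintro (_ | w) hw
      · exact absurd hw hnone
      · exact hβ w (Finset.mem_eraseNone.2 hw)
  interior_le := by
    have hsub : {w : Option W | ∀ i ≤ m, some (b i) ≠ w} ⊆
        insert none (some '' {w | ∀ i ≤ m, b i ≠ w}) := by
      rintro (_ | w) hw
      · simp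
      · right
        exact ⟨w, fun i hi hiw => hw i hi (congrArg some hiw), rfl⟩
    have h1 := Set.ncard_le_ncard hsub (Set.toFinite _)
    have h2 := Set.ncard_insert_le none (some '' {w | ∀ i ≤ m, b i ≠ w})
    have h3 := Set.ncard_image_le (f := some) (s := {w | ∀ i ≤ m, b i ≠ w}) (Set.toFinite _)
    have h4 := h.interior_le
    lia
  triangles_le := by
    have h1 := ncard_triangles_stellar_le h.triangle_mem
      (by rw [h.card_triangle]; norm_num) h.triangle_mem h.card_triangle subset_rfl
      (fun t ht hst => h.subset_triangle t ht (hst (by simp)) (hst (by simp)))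
    -- At most three triangles replace one: a gain of two, as `k` grows by one.
    have h2 := Finset.card_filter_le (Finset.powersetCard 2 ({b 0, b m, y} : Finset W))
      fun t => ¬ {b 0, b m, y} ⊆ t
    rw [Finset.card_powersetCard, h.card_triangle] at h2
    have h3 : Nat.choose 3 2 = 3 := rfl
    have h4 := h.triangles_le
    lia

/-- Subdivide the closing edge by a new boundary vertex. -/
theorem subdivide_edge [Finite W] (h : IsPartialFilling Y m k D b y β) {v : V}
    (hm : Y.Joint (β (b m)) v (β y)) :
    IsPartialFilling Y (m + 1) k
      (D.stellar {b 0, b m} h.closing_edge_mem (by rw [h.card_edge]; norm_num))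
      (fun i => if i ≤ m then some (b i) else none) (some y) (fun o => o.elim v β) where
  two_le := by have := h.two_le; lia
  inj i hi j hj hij := by
    split_ifs at hij with h1 h2 h2
    · exact h.inj i h1 j h2 (Option.some_injective _ hij)
    · lia
  edge_mem i hi := by
    have h2 := h.two_le
    by_cases him : i + 1 ≤ m
    · rw [if_pos (by lia), if_pos him]
      refine mem_stellar.2 ⟨by simp, fun hs => ?_, _, h.edge_mem i him, ?_, by simp⟩
      · have h3 := hs (show b 0 ∈ ({b 0, b m} : Finset W) by simp)
        have h4 := hs (show b m ∈ ({b 0, b m} : Finset W) by simp)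
        simp only [Finset.mem_eraseNone, Finset.mem_insert, Option.some.injEq,
          Finset.mem_singleton] at h3 h4
        have h5 := h.inj 0 (by lia) i (by lia)
        have h6 := h.inj 0 (by lia) (i + 1) (by lia)
        have h7 := h.inj m le_rfl i (by lia)
        have h8 := h.inj m le_rfl (i + 1) (by lia)
        grind
      · exact fun w hw => by simpa using hw
    · obtain rfl : i = m := by lia
      rw [if_pos le_rfl, if_neg (by lia)]
      refine mem_stellar.2 ⟨by simp, fun hs => ?_, _, h.closing_edge_mem, ?_, fun _ => subset_rfl⟩
      · have := hs (show b 0 ∈ ({b 0, b i} : Finset W) by simp)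
        simp [h.zero_ne_last] at this
      · intro w hw
        simp only [Finset.mem_eraseNone, Finset.mem_insert, Option.some.injEq,
          Finset.mem_singleton, reduceCtorEq, or_false] at hw
        simp [hw]
  triangle_mem := by
    rw [if_pos (by lia), if_neg (by lia)]
    refine mem_stellar.2 ⟨by simp, fun hs => ?_, _, h.triangle_mem, ?_, fun _ => by grind⟩
    · have := hs (show b m ∈ ({b 0, b m} : Finset W) by simp)
      simp [h.zero_ne_last.symm, h.ne_last.symm] at this
    · intro w hw
      simp only [Finset.mem_eraseNone, Finset.mem_insert, Option.some.injEq,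
        Finset.mem_singleton, reduceCtorEq, false_or] at hw
      grind
  ne_zero := by
    rw [if_pos (by lia)]
    simpa using h.ne_zero
  ne_last := by
    rw [if_neg (by lia)]
    simp
  subset_triangle t ht h0 hm := by
    rw [if_pos (by lia)] at h0 ⊢
    rw [if_neg (by lia)] at hm ⊢
    obtain ⟨hne, hst, u, hu, htu, hsu⟩ := mem_stellar.1 ht
    rw [← Finset.mem_eraseNone] at h0
    have hsu := hsu hm
    have hu' := h.subset_triangle u hu (hsu (by simp)) (hsu (by simp))
    rintro (_ | w) hw
    · simp
    · rw [← Finset.mem_eraseNone] at hw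
      have := hu' (htu hw)
      have hwy : w ≠ b m := by
        rintro rfl
        exact hst (by grind)
      grind
  exists_homeomorph := by
    obtain ⟨e, he⟩ := h.exists_homeomorph
    refine ⟨(stellarHomeomorph ..).trans e, fun x => ?_⟩
    rw [Homeomorph.trans_apply, he, stellarHomeomorph_apply]
    obtain ⟨hne, hst, -⟩ := mem_stellar.1 x.support_mem
    simp only [InPolygonEdge, mem_support_stellarMap]
    generalize x.1.support = t at *
    constructor
    · intro h'
      -- With `none` in the support, the image involves both `b 0` and `b m`, so only the old
      -- closing edge can contain it.
      have h'' : (∀ w, some w ∈ t ∨ none ∈ t ∧ w ∈ ({b 0, b m} : Finset W) →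
          w = b 0 ∨ w = b m) ∨ none ∉ t ∧ ∃ i < m, ∀ w, some w ∈ t ∨
            none ∈ t ∧ w ∈ ({b 0, b m} : Finset W) → w = b i ∨ w = b (i + 1) := by
        rcases h' with ⟨i, hi, h'⟩ | h'
        · by_cases hnone : none ∈ t
          · have h1 := h' (b 0) (Or.inr ⟨hnone, by simp⟩)
            have h2 := h' (b m) (Or.inr ⟨hnone, by simp⟩)
            have h3 := h.zero_ne_last
            left
            grind
          · exact Or.inr ⟨hnone, i, hi, h'⟩
        · exact Or.inl h'
      rcases h'' with h' | ⟨hnone, i, hi, h'⟩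
      -- The support cannot contain both `b 0` and `b m`, which decides the half of the old closing
      -- edge.
      · by_cases h0 : some (b 0) ∈ t
        · right
          rintro (_ | w) hw
          · right
            rw [if_neg (by lia)]
          · left
            rcases h' w (Or.inl hw) with rfl | rfl
            · rw [if_pos (by lia)]
            · refine absurd ?_ hst
              intro w' hw'
              rw [Finset.mem_insert, Finset.mem_singleton] at hw'
              rcases hw' with rfl | rfl <;> rwa [Finset.mem_eraseNone]
        · left
          refine ⟨m, by lia, ?_⟩
          rw [if_pos le_rfl, if_neg (by lia)]
          rintro (_ | w) hw
          · simp
          · rcases h' w (Or.inl hw) with rfl | rfl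
            · exact absurd hw h0
            · simp
      · left
        refine ⟨i, by lia, ?_⟩
        rw [if_pos (by lia), if_pos (by lia)]
        rintro (_ | w) hw
        · exact absurd hw hnone
        · simpa using h' w (Or.inl hw)
    · rintro (⟨i, hi, h'⟩ | h')
      · by_cases him : i + 1 ≤ m
        · rw [if_pos (by lia), if_pos him] at h'
          left
          refine ⟨i, him, ?_⟩
          rintro w (hw | ⟨hw, -⟩)
          · simpa using h' _ hw
          · simpa using h' _ hw
        · obtain rfl : i = m := by lia
          rw [if_pos le_rfl, if_neg (by lia)] at h'
          right
          rintro w (hw | ⟨-, hw⟩)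
          · right
            simpa using h' _ hw
          · simpa using hw
      · rw [if_pos (by lia), if_neg (by lia)] at h'
        right
        rintro w (hw | ⟨-, hw⟩)
        · left
          simpa using h' _ hw
        · simpa using hw
  simplicial t ht hn := by
    rw [if_pos (by lia), if_neg (by lia)] at hn
    obtain ⟨hne, hst, u, hu, htu, hsu⟩ := mem_stellar.1 ht
    by_cases hnone : none ∈ t
    · have hsu := hsu hnone
      have hut := h.subset_triangle u hu (hsu (by simp)) (hsu (by simp))
      obtain ⟨u0, hu0, h1, h2, h3⟩ := hm
      refine ⟨u0, hu0, ?_⟩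
      rintro (_ | w) hw
      · exact h2
      · have := hut (htu (Finset.mem_eraseNone.2 hw))
        simp only [Finset.mem_insert, Finset.mem_singleton] at this
        rcases this with rfl | rfl | rfl
        · exact absurd ⟨hw, hnone⟩ hn
        · exact h1
        · exact h3
    · rw [← map_some_eraseNone hnone, Finset.map_nonempty] at hne
      obtain ⟨u', hu', hβ⟩ := h.simplicial t.eraseNone (mem_of_subset hu htu hne)
        (fun h' => hst (by grind))
      refine ⟨u', hu', ?_⟩
      rintro (_ | w) hw
      · exact absurd hw hnone
      · exact hβ w (Finset.mem_eraseNone.2 hw)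
  interior_le := by
    have hsub : {w : Option W | ∀ i ≤ m + 1, (if i ≤ m then some (b i) else none) ≠ w} ⊆
        some '' {w | ∀ i ≤ m, b i ≠ w} := by
      rintro (_ | w) hw
      · exact absurd (if_neg (by lia)) (hw (m + 1) le_rfl)
      · refine ⟨w, fun i hi hiw => hw i (by lia) ?_, rfl⟩
        rw [if_pos hi, hiw]
    have h1 := Set.ncard_le_ncard hsub (Set.toFinite _)
    have h3 := Set.ncard_image_le (f := some) (s := {w | ∀ i ≤ m, b i ≠ w}) (Set.toFinite _)
    have h4 := h.interior_le
    lia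
  triangles_le := by
    have h1 := ncard_triangles_stellar_le h.closing_edge_mem
      (by rw [h.card_edge]; norm_num) h.triangle_mem h.card_triangle (by grind)
      (fun t ht hst => h.subset_triangle t ht (hst (by simp)) (hst (by simp)))
    -- The subdivided edge itself is not coned, so at most two triangles replace one: a gain of one,
    -- as `m` grows by one.
    have hsub : ((Finset.powersetCard 2 ({b 0, b m, y} : Finset W)).filter
        fun t => ¬ {b 0, b m} ⊆ t) ⊆ (Finset.powersetCard 2 {b 0, b m, y}).erase {b 0, b m} := by
      intro t ht
      rw [Finset.mem_filter] at ht
      refine Finset.mem_erase.2 ⟨?_, ht.1⟩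
      rintro rfl
      exact ht.2 subset_rfl
    have h2 := Finset.card_le_card hsub
    rw [Finset.card_erase_of_mem (Finset.mem_powersetCard.2 ⟨by grind, h.card_edge⟩),
      Finset.card_powersetCard, h.card_triangle] at h2
    have h3 : Nat.choose 3 2 = 3 := rfl
    have h4 := h.triangles_le
    lia

end IsPartialFilling

/-! ### Filling loops in an ample complex -/

open Realization

/-- The seed of every disc. Since faces on the closing edge are exempt, `β 0` and `β 2` need not be
adjacent. -/
theorem isPartialFilling_triangle {V : Type*} {Y : AbstractSimplicialComplex V} {β : Fin 3 → V}
    (h01 : {u | u ∈ Y ∧ β 0 ∈ u ∧ β 1 ∈ u}.Nonempty)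
    (h12 : {u | u ∈ Y ∧ β 1 ∈ u ∧ β 2 ∈ u}.Nonempty) :
    IsPartialFilling Y 2 0 ⊤ (fun i => Fin.ofNat 3 i) 1 β where
  two_le := le_rfl
  inj := by decide
  edge_mem i hi := Finset.insert_nonempty _ _
  triangle_mem := Finset.insert_nonempty _ _
  ne_zero := by decide
  ne_last := by decide
  subset_triangle t _ _ _ := (Finset.subset_univ t).trans (by decide)
  exists_homeomorph := by
    obtain ⟨e, he⟩ := exists_homeomorph_triangle
    refine ⟨e, fun x => (he x).trans ?_⟩
    have key : ∀ t : Finset (Fin 3), (∃ i, i ∉ t) ↔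
        (∃ i < 2, ∀ w ∈ t, w = Fin.ofNat 3 i ∨ w = Fin.ofNat 3 (i + 1)) ∨
          ∀ w ∈ t, w = Fin.ofNat 3 0 ∨ w = Fin.ofNat 3 2 := by decide
    simpa only [Finsupp.notMem_support_iff, InPolygonEdge] using key x.1.support
  simplicial t _ ht := by
    obtain ⟨u, hu, h0, h1⟩ := h01
    obtain ⟨u', hu', h1', h2⟩ := h12
    by_cases h : (0 : Fin 3) ∈ t
    · refine ⟨u, hu, fun w hw => ?_⟩
      fin_cases w
      exacts [h0, h1, absurd ⟨h, hw⟩ ht]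
    · refine ⟨u', hu', fun w hw => ?_⟩
      fin_cases w
      exacts [absurd hw h, h1', h2]
  interior_le := by
    have : {w : Fin 3 | ∀ i ≤ 2, Fin.ofNat 3 i ≠ w} = ∅ := by
      rw [Set.eq_empty_iff_forall_notMem]
      intro w hw
      exact hw w (by lia) (by simp)
    rw [this, Set.ncard_empty]
  triangles_le := by
    have hsub : {t : Finset (Fin 3) | t ∈ (⊤ : AbstractSimplicialComplex (Fin 3)) ∧ t.card = 3} ⊆
        {Finset.univ} := fun t ht => Finset.eq_univ_of_card t (by simpa using ht.2)
    have := Set.ncard_le_ncard hsub (Set.finite_singleton _)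
    rw [Set.ncard_singleton] at this
    lia

theorem isSimplicialMap_of_exists {V W : Type*} {K : AbstractSimplicialComplex V}
    {L : AbstractSimplicialComplex W} {f : V → W}
    (h : ∀ s ∈ K, ∃ u ∈ L, ∀ v ∈ s, f v ∈ u) : IsSimplicialMap K L f := by
  classical
  intro s hs
  obtain ⟨u, hu, h'⟩ := h s hs
  refine mem_of_subset hu (fun w hw => ?_) ((nonempty_of_mem hs).image _)
  obtain ⟨v, hv, rfl⟩ := Finset.mem_image.1 hw
  exact h' v hv

section Filling

variable {V : Type*} {Y : AbstractSimplicialComplex V}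

theorem Joint.rotate {p q r : V} (h : Y.Joint p q r) : Y.Joint q r p :=
  let ⟨u, hu, h1, h2, h3⟩ := h
  ⟨u, hu, h2, h3, h1⟩

theorem Joint.swap {p q r : V} (h : Y.Joint p q r) : Y.Joint q p r :=
  let ⟨u, hu, h1, h2, h3⟩ := h
  ⟨u, hu, h2, h1, h3⟩

/-- There is a partial filling of the closed polygon `a 0, …, a m` in which the third vertex of
the triangle at the closing edge is mapped to `c`. -/
def HasPartialFilling (Y : AbstractSimplicialComplex V) (m k : ℕ) (a : ℕ → V) (c : V) : Prop :=
  ∃ (W : Type) (_ : Finite W) (_ : DecidableEq W) (D : AbstractSimplicialComplex W) (b : ℕ → W)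
    (y : W) (β : W → V),
    IsPartialFilling Y m k D b y β ∧ (∀ i ≤ m, β (b i) = a i) ∧ β y = c

namespace HasPartialFilling

theorem triangle {a : ℕ → V} (h01 : ∃ u ∈ Y, a 0 ∈ u ∧ a 1 ∈ u)
    (h12 : ∃ u ∈ Y, a 1 ∈ u ∧ a 2 ∈ u) : HasPartialFilling Y 2 0 a (a 1) :=
  ⟨Fin 3, inferInstance, inferInstance, ⊤, fun i => Fin.ofNat 3 i, 1, fun i => a i,
    isPartialFilling_triangle h01 h12, fun i hi => by interval_cases i <;> rfl, rfl⟩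

variable {m k : ℕ} {a : ℕ → V} {c v : V}

theorem congr (h : HasPartialFilling Y m k a c) {a' : ℕ → V} (ha : ∀ i ≤ m, a i = a' i) :
    HasPartialFilling Y m k a' c := by
  obtain ⟨W, i1, i2, D, b, y, β, h, hβ, hy⟩ := h
  exact ⟨W, i1, i2, D, b, y, β, h, fun i hi => (hβ i hi).trans (ha i hi), hy⟩

theorem mono (h : HasPartialFilling Y m k a c) {k' : ℕ} (hk : k ≤ k') :
    HasPartialFilling Y m k' a c := by
  obtain ⟨W, i1, i2, D, b, y, β, h, hβ⟩ := h
  refine ⟨W, i1, i2, D, b, y, β, { h with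
    interior_le := h.interior_le.trans hk
    triangles_le := h.triangles_le.trans (by lia) }, hβ⟩

theorem subdivide_triangle (h : HasPartialFilling Y m k a c) (h0 : Y.Joint (a 0) c v)
    (hm : Y.Joint (a m) c v) : HasPartialFilling Y m (k + 1) a v := by
  obtain ⟨W, _, _, D, b, y, β, h, hβ, rfl⟩ := h
  rw [← hβ _ (Nat.zero_le _)] at h0
  rw [← hβ _ le_rfl] at hm
  exact ⟨_, inferInstance, inferInstance, _, _, _, _, h.subdivide_triangle h0 hm, hβ, rfl⟩

theorem subdivide_edge (h : HasPartialFilling Y m k a c) (hm : Y.Joint (a m) (a (m + 1)) c) :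
    HasPartialFilling Y (m + 1) k a c := by
  obtain ⟨W, _, _, D, b, y, β, h, hβ, rfl⟩ := h
  rw [← hβ _ le_rfl] at hm
  refine ⟨_, inferInstance, inferInstance, _, _, _, _, h.subdivide_edge hm, fun i hi => ?_, rfl⟩
  split_ifs with hi'
  · exact hβ i hi'
  · obtain rfl : i = m + 1 := by lia
    rfl

theorem subdivide_edges (h : HasPartialFilling Y m k a c) {l : ℕ} (hml : m ≤ l)
    (hj : ∀ j, m ≤ j → j < l → Y.Joint (a j) (a (j + 1)) c) : HasPartialFilling Y l k a c := by
  induction l, hml using Nat.le_induction with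
  | base => exact h
  | succ l hl ih =>
    exact (ih fun j h1 h2 => hj j h1 (by lia)).subdivide_edge (hj l hl (by lia))

/-- The faces still exempt from simpliciality all lie in the triangle at the closing edge, which
`h0` sends into a simplex. -/
theorem exists_isDiscTriangulation (h : HasPartialFilling Y m k a c)
    (h0 : Y.Joint (a 0) (a m) c) :
    ∃ (W : Type) (_ : Finite W) (D : AbstractSimplicialComplex W) (b : ZMod (m + 1) → W)
      (β : W → V), D.IsDiscTriangulation (m + 1) b ∧ IsSimplicialMap D Y β ∧
        (∀ i, β (b i) = a i.val) ∧ {w : W | w ∉ Set.range b}.ncard ≤ k ∧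
        {s : Finset W | s ∈ D ∧ s.card = 3}.ncard + 1 ≤ 2 * k + m := by
  obtain ⟨W, _, _, D, b, y, β, h, hβ, rfl⟩ := h
  have hval : ∀ i : ZMod (m + 1), i.val ≤ m := fun i => Nat.lt_succ_iff.1 i.val_lt
  have hcast : ∀ i ≤ m, ((i : ℕ) : ZMod (m + 1)).val = i := fun i hi =>
    ZMod.val_cast_of_lt (Nat.lt_succ_iff.2 hi)
  have hsucc : ∀ i : ZMod (m + 1), i.val < m ∧ (i + 1).val = i.val + 1 ∨
      i.val = m ∧ (i + 1).val = 0 := by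
    intro i
    rcases (hval i).lt_or_eq with hi | hi
    · refine Or.inl ⟨hi, ?_⟩
      rw [← ZMod.natCast_zmod_val i, ← Nat.cast_succ, hcast _ hi, hcast _ hi.le]
    · refine Or.inr ⟨hi, ?_⟩
      rw [← ZMod.natCast_zmod_val i, hi, ← Nat.cast_succ, ZMod.natCast_self, ZMod.val_zero]
  refine ⟨W, inferInstance, D, fun i => b i.val, β, ⟨?_, ?_, ?_⟩, ?_, fun i => hβ _ (hval i),
    ?_, h.triangles_le⟩
  · exact fun i j hij => ZMod.val_injective _ (h.inj _ (hval i) _ (hval j) hij)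
  · refine isSimplicialMap_of_exists ?_
    rintro s ⟨-, i, hi⟩
    have hle : ∀ j ∈ s, b j.val = b i.val ∨ b j.val = b (i + 1).val := by
      intro j hj
      have := hi hj
      grind
    rcases hsucc i with ⟨h1, h2⟩ | ⟨h1, h2⟩
    · rw [h2] at hle
      exact ⟨_, h.edge_mem _ h1, by simpa using hle⟩
    · rw [h1, h2] at hle
      exact ⟨_, h.closing_edge_mem, by simpa [or_comm] using hle⟩
  · obtain ⟨e, he⟩ := h.exists_homeomorph
    refine ⟨e, fun x => (he x).trans ⟨?_, ?_⟩⟩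
    · rintro (⟨i, hi, hx⟩ | hx)
      · refine ⟨(i : ZMod (m + 1)), fun w hw => ?_⟩
        rw [← Nat.cast_succ, hcast _ hi.le, hcast _ hi]
        exact hx w hw
      · refine ⟨(m : ZMod (m + 1)), fun w hw => ?_⟩
        rw [← Nat.cast_succ, hcast _ le_rfl, ZMod.natCast_self, ZMod.val_zero]
        exact (hx w hw).symm
    · rintro ⟨i, hx⟩
      rcases hsucc i with ⟨h1, h2⟩ | ⟨h1, h2⟩
      · rw [h2] at hx
        exact Or.inl ⟨_, h1, fun w hw => hx hw⟩
      · rw [h1, h2] at hx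
        exact Or.inr fun w hw => (hx hw).symm
  · refine isSimplicialMap_of_exists fun s hs => ?_
    by_cases hb : b 0 ∈ s ∧ b m ∈ s
    · obtain ⟨u, hu, h1, h2, h3⟩ := h0
      rw [← hβ _ (Nat.zero_le _)] at h1
      rw [← hβ _ le_rfl] at h2
      refine ⟨u, hu, fun w hw => ?_⟩
      have := h.subset_triangle s hs hb.1 hb.2 hw
      simp only [Finset.mem_insert, Finset.mem_singleton] at this
      rcases this with rfl | rfl | rfl
      exacts [h1, h2, h3]
    · exact h.simplicial s hs hb
  · convert h.interior_le using 4 with w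
    simp only [Set.mem_range, not_exists]
    exact ⟨fun hw i hi => by simpa [hcast i hi] using hw i, fun hw i => hw _ (hval i)⟩

end HasPartialFilling

variable {r : ℕ}

/-- In an ample complex the vertices of a short polygon have a common cone vertex. -/
theorem IsAmple.exists_joint [DecidableEq V] (hY : Y.IsAmple r) {U : Finset V} (hU : U.card ≤ r) :
    ∃ v, ∀ p ∈ U, ∀ q ∈ U, {p, q} ∈ Y → Y.Joint p q v := by
  obtain ⟨v, hv⟩ := hY.exists_cone hU
  exact ⟨v, fun p hp q hq hpq => ⟨_, hv _ hpq (by grind), by simp, by simp, by simp⟩⟩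

/-- One cone vertex serves all edges. The `max` is for `m = 2`: a partial filling needs three
boundary vertices, so there it already includes `a m`. -/
theorem IsAmple.hasPartialFilling_of_le [DecidableEq V] (hY : Y.IsAmple r) {m : ℕ}
    (hm : 2 ≤ m) (hmr : m + 1 ≤ r) {a : ℕ → V} (ha : ∀ i < m, {a i, a (i + 1)} ∈ Y) (h0 : {a 0, a m} ∈ Y) :
    ∃ c, HasPartialFilling Y (max 2 (m - 1)) 1 a c ∧ Y.Joint (a (m - 1)) (a m) c ∧
      Y.Joint (a 0) (a m) c := by
  obtain ⟨c, hc⟩ := hY.exists_joint (U := (Finset.range (m + 1)).image a)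
    (Finset.card_image_le.trans (by simpa using hmr))
  have hmem : ∀ i ≤ m, a i ∈ (Finset.range (m + 1)).image a := fun i hi =>
    Finset.mem_image_of_mem a (by simpa [Nat.lt_succ_iff] using hi)
  have hj : ∀ i < m, Y.Joint (a i) (a (i + 1)) c := fun i hi =>
    hc _ (hmem i hi.le) _ (hmem _ hi) (ha i hi)
  refine ⟨c, ?_, ?_, hc _ (hmem 0 (by lia)) _ (hmem m le_rfl) h0⟩
  · have h1 : HasPartialFilling Y 2 0 a (a 1) := .triangle
      ⟨_, ha 0 (by lia), by simp, by simp⟩ ⟨_, ha 1 (by lia), by simp, by simp⟩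
    have h2 := h1.subdivide_triangle (v := c) (hj 0 (by lia)) (hj 1 (by lia)).swap
    exact h2.subdivide_edges (le_max_left _ _) fun j _ h => hj j (by lia)
  · have := hj (m - 1) (by lia)
    rwa [Nat.sub_add_cancel (by lia)] at this

/-- Stopping at `a (m - 1)` leaves two uses for `a m`: on the boundary it completes the disc, while
as the cone vertex of a longer loop it becomes interior. The two joints with `c` permit either. -/
theorem IsAmple.hasPartialFilling [DecidableEq V] (hr : 4 ≤ r) (hY : Y.IsAmple r) (k : ℕ)
    {m : ℕ} (hm : 3 ≤ m) (hmk : m - 2 ≤ (k + 1) * (r - 3)) {a : ℕ → V} (ha : ∀ i < m, {a i, a (i + 1)} ∈ Y)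
    (h0 : {a 0, a m} ∈ Y) :
    ∃ c, HasPartialFilling Y (m - 1) (k + 1) a c ∧ Y.Joint (a (m - 1)) (a m) c ∧
      Y.Joint (a 0) (a m) c := by
  induction k generalizing m a with
  | zero =>
    have := hY.hasPartialFilling_of_le (by lia) (by lia) ha h0
    rwa [max_eq_right (by lia)] at this
  | succ k ih =>
    by_cases hmr : m + 1 ≤ r
    · obtain ⟨c, hc, h⟩ := hY.hasPartialFilling_of_le (by lia) hmr ha h0
      rw [max_eq_right (by lia)] at hc
      exact ⟨c, hc.mono (by lia), h⟩
    -- The indices `l, …, m` together with `0` are `r` in number, all that a cone may use. The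
    -- shorter loop ends at `l + 1 = m - (r - 3)`.
    obtain ⟨l, rfl⟩ : ∃ l, m = l + (r - 2) := ⟨m - (r - 2), by lia⟩
    have hl : 2 ≤ l := by lia
    obtain ⟨v, hv⟩ := hY.exists_joint
      (U := insert (a 0) ((Finset.Icc l (l + (r - 2))).image a))
      ((Finset.card_insert_le _ _).trans (by
        have := Finset.card_image_le (s := Finset.Icc l (l + (r - 2))) (f := a)
        rw [Nat.card_Icc] at this
        lia))
    have hmem : ∀ i, l ≤ i → i ≤ l + (r - 2) →
        a i ∈ insert (a 0) ((Finset.Icc l (l + (r - 2))).image a) := fun i h1 h2 =>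
      Finset.mem_insert_of_mem (Finset.mem_image_of_mem a (Finset.mem_Icc.2 ⟨h1, h2⟩))
    have hj : ∀ i, l ≤ i → i < l + (r - 2) → Y.Joint (a i) (a (i + 1)) v := fun i h1 h2 =>
      hv _ (hmem i h1 h2.le) _ (hmem _ (by lia) h2) (ha i h2)
    have hj0 := hv _ (Finset.mem_insert_self _ _) _ (hmem _ (by lia) le_rfl) h0
    have hface : ∀ {p q : V}, Y.Joint p q v → {p, v} ∈ Y := fun ⟨u, hu, h1, _, h3⟩ =>
      mem_of_subset hu (by grind) (by simp)
    let a' : ℕ → V := fun i => if i ≤ l then a i else v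
    have ha' : ∀ i ≤ l, a' i = a i := fun i hi => if_pos hi
    have hv' : a' (l + 1) = v := if_neg (by lia)
    obtain ⟨c, hc, h1, h2⟩ := ih (m := l + 1) (a := a') (by lia)
      (by
        have h3 : (k + 1 + 1) * (r - 3) = (k + 1) * (r - 3) + (r - 3) := by ring
        rw [h3] at hmk
        lia)
      (fun i hi => by
        rcases (Nat.lt_succ_iff.1 hi).lt_or_eq with hi' | rfl
        · rw [ha' _ hi'.le, ha' _ hi']
          exact ha i (by lia)
        · rw [ha' _ le_rfl, hv']
          exact hface (hj i le_rfl (by lia)))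
      (by
        rw [ha' _ (by lia), hv']
        exact hface hj0)
    rw [Nat.add_sub_cancel] at hc h1
    rw [hv', ha' _ (by lia)] at h1 h2
    -- The vertex `v` becomes interior and replaces `c` at the closing edge; the remaining edges are
    -- fanned out from it.
    have hc' := ((hc.congr ha').subdivide_triangle h2.swap.rotate h1.swap.rotate).subdivide_edges
      (l := l + (r - 2) - 1) (by lia) fun j h3 h4 => hj j h3 (by lia)
    refine ⟨v, hc', ?_, hj0⟩
    have := hj (l + (r - 2) - 1) (by lia) (by lia)
    rwa [Nat.sub_add_cancel (by lia)] at this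

end Filling

end AbstractSimplicialComplex

theorem proposition6p1 {V : Type*} (Y : AbstractSimplicialComplex V) (r : ℕ) (hr : 4 ≤ r)
    (hY : Y.IsAmple r) :
    SimplyConnectedSpace Y.Realization ∧
      ∀ (n : ℕ), 3 ≤ n → ∀ α : ZMod n → V,
        AbstractSimplicialComplex.IsSimplicialMap (AbstractSimplicialComplex.cycle n) Y α →
        ∃ (W : Type) (_ : Finite W) (D : AbstractSimplicialComplex W) (b : ZMod n → W)
          (β : W → V),
          D.IsDiscTriangulation n b ∧
          AbstractSimplicialComplex.IsSimplicialMap D Y β ∧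
          (∀ i, β (b i) = α i) ∧
          {w : W | w ∉ Set.range b}.ncard ≤ max 1 ⌈((n : ℚ) - 3) / ((r : ℚ) - 3)⌉₊ ∧
          {s : Finset W | s ∈ D ∧ s.card = 3}.ncard ≤
            max 3 (⌈((n : ℚ) - 3) / ((r : ℚ) - 3)⌉₊ * (r - 1) + 1) := by
  classical
  refine ⟨AbstractSimplicialComplex.Realization.simplyConnectedSpace_of_isAmple hr hY,
    fun n hn α hα => ?_⟩
  obtain ⟨m, rfl⟩ : ∃ m, n = m + 1 := ⟨n - 1, by lia⟩
  let a : ℕ → V := fun i => α i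
  have hedge : ∀ i : ZMod (m + 1), {α i, α (i + 1)} ∈ Y := fun i => by
    have := hα {i, i + 1} ⟨by simp, i, subset_rfl⟩
    convert this using 1
    ext
    simp
  have ha : ∀ i < m, {a i, a (i + 1)} ∈ Y := fun i _ => by
    simpa [a] using hedge i
  have h0 : {a 0, a m} ∈ Y := by
    have := hedge m
    rw [← Nat.cast_succ, ZMod.natCast_self, Finset.pair_comm] at this
    simpa [a] using this
  have hαa : ∀ i : ZMod (m + 1), a i.val = α i := fun i => by
    simp [a]
  obtain ⟨k, hk⟩ : ∃ k, k = ⌈(((m + 1 : ℕ) : ℚ) - 3) / ((r : ℚ) - 3)⌉₊ := ⟨_, rfl⟩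
  rw [← hk]
  -- For `n = 3` the ceiling is zero, but the three vertices need not span a simplex, so one cone
  -- vertex is used.
  obtain rfl | hm : m = 2 ∨ 3 ≤ m := by lia
  · obtain ⟨c, hc, -, h⟩ := hY.hasPartialFilling_of_le le_rfl (by lia) ha h0
    obtain ⟨W, hW, D, b, β, h1, h2, h3, h4, h5⟩ := hc.exists_isDiscTriangulation h
    exact ⟨W, hW, D, b, β, h1, h2, fun i => (h3 i).trans (hαa i), h4.trans (le_max_left _ _),
      le_max_of_le_left (by lia)⟩
  · have hr' : (0 : ℚ) < (r : ℚ) - 3 := by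
      have : (4 : ℚ) ≤ r := by exact_mod_cast hr
      linarith
    have hm' : (0 : ℚ) < ((m + 1 : ℕ) : ℚ) - 3 := by
      have : (3 : ℚ) ≤ m := by exact_mod_cast hm
      push_cast
      linarith
    have hkpos : 0 < k := by
      rw [hk]
      exact Nat.ceil_pos.2 (div_pos hm' hr')
    obtain ⟨k, rfl⟩ : ∃ k', k = k' + 1 := ⟨k - 1, by lia⟩
    have hle : m - 2 ≤ (k + 1) * (r - 3) := by
      have h1 := Nat.le_ceil ((((m + 1 : ℕ) : ℚ) - 3) / ((r : ℚ) - 3))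
      rw [← hk, div_le_iff₀ hr'] at h1
      have h2 : ((m - 2 : ℕ) : ℚ) ≤ ((k + 1) * (r - 3) : ℕ) := by
        rw [Nat.cast_mul, Nat.cast_sub (by lia), Nat.cast_sub (by lia)]
        push_cast at h1 ⊢
        linarith
      exact_mod_cast h2
    obtain ⟨c, hc, hj, h⟩ := hY.hasPartialFilling hr k hm hle ha h0
    -- Here `a m` is placed on the boundary; `h` then takes care of the closing triangle.
    have hc' := hc.subdivide_edge (by rwa [Nat.sub_add_cancel (by lia)])
    rw [Nat.sub_add_cancel (by lia)] at hc'
    obtain ⟨W, hW, D, b, β, h1, h2, h3, h4, h5⟩ := hc'.exists_isDiscTriangulation h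
    refine ⟨W, hW, D, b, β, h1, h2, fun i => (h3 i).trans (hαa i), h4.trans (le_max_right _ _),
      le_max_of_le_right ?_⟩
    -- The count to bound is `2 (k + 1) + (m - 2) + 1`, with `m - 2` controlled by `hle`.
    have h6 : (k + 1) * (r - 1) = (k + 1) * (r - 3) + 2 * (k + 1) := by
      rw [show r - 1 = r - 3 + 2 by lia]
      ring
    lia
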